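/- Let $k$ be a field, and let $A$ and $H$ be Hopf algebras over $k$ (the antipodes are not assumed bijective). Let $\mathcal M^A$ denote the $k$-linear tensor category of right $A$-comodules, with the diagonal coaction on tensor products. Let $\mathcal{YD}_A^A$ denote the $k$-linear tensor category of (right-right) Yetter–Drinfeld modules over $A$. Its objects are the right $A$-comodules $V$ that are also right $A$-modules such that $$(v\leftarrow a)_{(0)}\otimes (v\leftarrow a)_{(1)} = v_{(0)}\leftarrow a_{(2)}\otimes S(a_{(1)})\,v_{(1)}\,a_{(3)}\qquad (v\in V,\ a\in A),$$ its morphisms are the $A$-linear $A$-colinear maps, and tensor products carry the diagonal action and coaction. For $V\in\mathcal M^A$ let $V\boxtimes A\in\mathcal{YD}_A^A$ be the space $V\otimes A$ with $A$ acting by right multiplication and with coaction $v\otimes a\mapsto v_{(0)}\otimes a_{(2)}\otimes S(a_{(1)})v_{(1)}a_{(3)}$; this defines a functor $\mathcal M^A\to\mathcal{YD}_A^A$. A Yetter–Drinfeld module is free if it is isomorphic to some $V\boxtimes A$. A free Yetter–Drinfeld resolution of the counit of $A$ is a complex $\cdots\to P_1\to P_0\to 0$ of free Yetter–Drinfeld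 modules for which there is a morphism $P_0\to k$ in $\mathcal{YD}_A^A$ making $\cdots\to P_1\to P_0\to k\to 0$ exact, where $k$ has the trivial coaction and the action of $A$ through its counit. The length of a complex is the supremum in $\mathbb N\cup\{\infty\}$ of the degrees of its nonzero terms. **Theorem.** Let $\Theta:\mathcal M^A\simeq^\otimes\mathcal M^H$ be an equivalence of $k$-linear tensor categories (with $\Theta$ a strong tensor functor). Then there is an equivalence of $k$-linear tensor categories $\widehat\Theta:\mathcal{YD}_A^A\simeq^\otimes\mathcal{YD}_H^H$ that is induced by $\Theta$, in the sense that $R_H\circ\widehat\Theta\simeq\Theta\circ R_A$ as tensor functors, where $R_A:\mathcal{YD}_A^A\to\mathcal M^A$ and $R_H:\mathcal{YD}_H^H\to\mathcal M^H$ are the forgetful functors, together with isomorphisms $$\widehat\Theta(V\boxtimes A)\simeq\Theta(V)\boxtimes H,$$ natural in $V\in\mathcal M^A$, such that: 1. for every free Yetter–Drinfeld resolution $P_\bullet$ of the counit of $A$, the complex $\widehat\Theta(P_\bullet)$ is a free Yetter–Drinfeld resolution of the counit of $H$, of the same length; 2. for every free Yetter–Drinfeld resolution of the counit of $A$ of the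 form $$V_\bullet\boxtimes A:\ \cdots\to V_{n+1}\boxtimes A\to V_n\boxtimes A\to\cdots\to V_0\boxtimes A\to 0$$ with $V_n\in\mathcal M^A$, the sequence $$\Theta(V_\bullet)\boxtimes H:\ \cdots\to\Theta(V_{n+1})\boxtimes H\to\Theta(V_n)\boxtimes H\to\cdots\to\Theta(V_0)\boxtimes H\to 0,$$ whose differentials are the images under $\widehat\Theta$ of the original ones, transported along the isomorphisms above, is a free Yetter–Drinfeld resolution of the counit of $H$, of the same length. -/

import Mathlib

open TensorProduct Coalgebra CategoryTheory

universe u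

noncomputable section

/-- Induction on a threefold tensor product. -/
theorem triple_induction {R M N P : Type*} [CommRing R] [AddCommGroup M] [Module R M]
    [AddCommGroup N] [Module R N] [AddCommGroup P] [Module R P]
    {p : M ⊗[R] (N ⊗[R] P) → Prop} (zero : p 0)
    (tmul : ∀ x y z, p (x ⊗ₜ (y ⊗ₜ z))) (add : ∀ x y, p x → p y → p (x + y))
    (t : M ⊗[R] (N ⊗[R] P)) : p t := by
  induction t with
  | zero => exact zero
  | add x y hx hy => exact add x y hx hy
  | tmul x u =>
    induction u with
    | zero => rwa [TensorProduct.tmul_zero]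
    | add u v hu hv => rw [TensorProduct.tmul_add]; exact add _ _ hu hv
    | tmul y z => exact tmul x y z

section DiagonalCoaction
set_option linter.unusedSimpArgs false
variable {k A : Type u} [Field k] [Ring A] [HopfAlgebra k A]
variable {U V W : Type u} [AddCommGroup U] [Module k U] [AddCommGroup V] [Module k V]
  [AddCommGroup W] [Module k W]

/-- For linear maps `ρ : V → V ⊗ A` and `σ : W → W ⊗ A`, the diagonal map
`V ⊗ W → (V ⊗ W) ⊗ A`, `v ⊗ w ↦ (v₍₀₎ ⊗ w₍₀₎) ⊗ v₍₁₎ w₍₁₎`. -/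
def diagCoact (ρ : V →ₗ[k] V ⊗[k] A) (σ : W →ₗ[k] W ⊗[k] A) :
    V ⊗[k] W →ₗ[k] (V ⊗[k] W) ⊗[k] A :=
  (LinearMap.mul' k A).lTensor (V ⊗[k] W) ∘ₗ
    (TensorProduct.tensorTensorTensorComm k V A W A).toLinearMap ∘ₗ TensorProduct.map ρ σ

theorem diagCoact_tmul (ρ : V →ₗ[k] V ⊗[k] A) (σ : W →ₗ[k] W ⊗[k] A) (v : V) (w : W) :
    diagCoact ρ σ (v ⊗ₜ w) = (LinearMap.mul' k A).lTensor (V ⊗[k] W)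
      (TensorProduct.tensorTensorTensorComm k V A W A (ρ v ⊗ₜ σ w)) :=
  rfl

theorem diagCoact_counit (ρ : V →ₗ[k] V ⊗[k] A) (σ : W →ₗ[k] W ⊗[k] A)
    (hρ : ∀ v, TensorProduct.rid k V ((counit (R := k) (A := A)).lTensor V (ρ v)) = v)
    (hσ : ∀ w, TensorProduct.rid k W ((counit (R := k) (A := A)).lTensor W (σ w)) = w)
    (x : V ⊗[k] W) :
    TensorProduct.rid k (V ⊗[k] W)
      ((counit (R := k) (A := A)).lTensor (V ⊗[k] W) (diagCoact ρ σ x)) = x := by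
  induction x with
  | zero => simp
  | add x y hx hy => simp only [map_add, hx, hy]
  | tmul v w =>
    rw [diagCoact_tmul]
    conv_rhs => rw [← hρ v, ← hσ w]
    generalize ρ v = x
    generalize σ w = y
    induction x with
    | zero => simp
    | add x y hx hy => simp only [map_add, TensorProduct.add_tmul, hx, hy]
    | tmul v a =>
    induction y with
    | zero => simp
    | add x y hx hy => simp only [map_add, TensorProduct.tmul_add, hx, hy]
    | tmul w b =>
      simp [mul_smul, TensorProduct.smul_tmul', smul_comm (counit (R := k) a)]

theorem diagCoact_coassoc (ρ : V →ₗ[k] V ⊗[k] A) (σ : W →ₗ[k] W ⊗[k] A)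
    (hρ : ∀ v, TensorProduct.assoc k V A A (ρ.rTensor A (ρ v)) =
      (comul (R := k) (A := A)).lTensor V (ρ v))
    (hσ : ∀ w, TensorProduct.assoc k W A A (σ.rTensor A (σ w)) =
      (comul (R := k) (A := A)).lTensor W (σ w))
    (x : V ⊗[k] W) :
    TensorProduct.assoc k (V ⊗[k] W) A A ((diagCoact ρ σ).rTensor A (diagCoact ρ σ x)) =
      (comul (R := k) (A := A)).lTensor (V ⊗[k] W) (diagCoact ρ σ x) := by
  induction x with
  | zero => simp
  | add x y hx hy => simp only [map_add, hx, hy]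
  | tmul v w =>
    let Φ : (V ⊗[k] (A ⊗[k] A)) ⊗[k] (W ⊗[k] (A ⊗[k] A)) →ₗ[k]
        (V ⊗[k] W) ⊗[k] (A ⊗[k] A) :=
      (LinearMap.mul' k (A ⊗[k] A)).lTensor _ ∘ₗ
        (TensorProduct.tensorTensorTensorComm k V (A ⊗[k] A) W (A ⊗[k] A)).toLinearMap
    trans Φ (TensorProduct.assoc k _ _ _ (ρ.rTensor A (ρ v)) ⊗ₜ
      TensorProduct.assoc k _ _ _ (σ.rTensor A (σ w)))
    · rw [diagCoact_tmul]
      generalize ρ v = x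
      generalize σ w = y
      induction x with
      | zero => simp
      | add x y hx hy => simp only [map_add, TensorProduct.add_tmul, hx, hy]
      | tmul v a =>
      induction y with
      | zero => simp
      | add x y hx hy => simp only [map_add, TensorProduct.tmul_add, hx, hy]
      | tmul w b =>
      simp only [TensorProduct.tensorTensorTensorComm_tmul, LinearMap.lTensor_tmul,
        LinearMap.rTensor_tmul, diagCoact_tmul]
      generalize ρ v = x
      generalize σ w = y
      induction x with
      | zero => simp
      | add x y hx hy => simp only [map_add, TensorProduct.add_tmul, hx, hy]
      | tmul v c =>
      induction y with
      | zero => simp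
      | add x y hx hy => simp only [map_add, TensorProduct.tmul_add, TensorProduct.add_tmul, hx, hy]
      | tmul w d => simp [Φ]
    · rw [hρ, hσ, diagCoact_tmul]
      generalize ρ v = x
      generalize σ w = y
      induction x with
      | zero => simp
      | add x y hx hy => simp only [map_add, TensorProduct.add_tmul, hx, hy]
      | tmul v a =>
      induction y with
      | zero => simp
      | add x y hx hy => simp only [map_add, TensorProduct.tmul_add, hx, hy]
      | tmul w b => simp [Φ]

theorem diagCoact_map {V' W' : Type u} [AddCommGroup V'] [Module k V']
    [AddCommGroup W'] [Module k W'] {ρ : V →ₗ[k] V ⊗[k] A} {σ : W →ₗ[k] W ⊗[k] A}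
    {ρ' : V' →ₗ[k] V' ⊗[k] A} {σ' : W' →ₗ[k] W' ⊗[k] A} (f : V →ₗ[k] V') (g : W →ₗ[k] W')
    (hf : ∀ v, ρ' (f v) = f.rTensor A (ρ v)) (hg : ∀ w, σ' (g w) = g.rTensor A (σ w))
    (x : V ⊗[k] W) :
    diagCoact ρ' σ' (TensorProduct.map f g x) =
      (TensorProduct.map f g).rTensor A (diagCoact ρ σ x) := by
  induction x with
  | zero => simp
  | add x y hx hy => simp only [map_add, hx, hy]
  | tmul v w =>
    rw [TensorProduct.map_tmul, diagCoact_tmul, diagCoact_tmul, hf, hg]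
    generalize ρ v = x
    generalize σ w = y
    induction x with
    | zero => simp
    | add x y hx hy => simp only [map_add, TensorProduct.add_tmul, hx, hy]
    | tmul v a =>
    induction y with
    | zero => simp
    | add x y hx hy => simp only [map_add, TensorProduct.tmul_add, hx, hy]
    | tmul w b => simp

theorem diagCoact_assoc (ρ : U →ₗ[k] U ⊗[k] A) (σ : V →ₗ[k] V ⊗[k] A) (τ : W →ₗ[k] W ⊗[k] A)
    (x : (U ⊗[k] V) ⊗[k] W) :
    diagCoact ρ (diagCoact σ τ) (TensorProduct.assoc k U V W x) =
      (TensorProduct.assoc k U V W).toLinearMap.rTensor A (diagCoact (diagCoact ρ σ) τ x) := by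
  induction x with
  | zero => simp
  | add x y hx hy => simp only [map_add, hx, hy]
  | tmul x w =>
  induction x with
  | zero => simp
  | add x y hx hy => simp only [map_add, TensorProduct.add_tmul, hx, hy]
  | tmul u v =>
  rw [TensorProduct.assoc_tmul, diagCoact_tmul, diagCoact_tmul, diagCoact_tmul, diagCoact_tmul]
  generalize ρ u = x
  generalize σ v = y
  generalize τ w = z
  induction x with
  | zero => simp
  | add x y hx hy => simp only [map_add, TensorProduct.add_tmul, hx, hy]
  | tmul u a =>
  induction y with
  | zero => simp
  | add x y hx hy => simp only [map_add, TensorProduct.tmul_add, TensorProduct.add_tmul, hx, hy]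
  | tmul v b =>
  induction z with
  | zero => simp
  | add x y hx hy => simp only [map_add, TensorProduct.tmul_add, hx, hy]
  | tmul w c => simp [mul_assoc]

theorem diagCoact_lid (σ : V →ₗ[k] V ⊗[k] A) (x : k ⊗[k] V) :
    σ (TensorProduct.lid k V x) = (TensorProduct.lid k V).toLinearMap.rTensor A
      (diagCoact ((TensorProduct.mk k k A).flip 1) σ x) := by
  induction x with
  | zero => simp
  | add x y hx hy => simp only [map_add, hx, hy]
  | tmul c v =>
  rw [diagCoact_tmul, TensorProduct.lid_tmul, map_smul]
  generalize σ v = x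
  induction x with
  | zero => simp
  | add x y hx hy => simp only [map_add, TensorProduct.tmul_add, smul_add, hx, hy]
  | tmul v b => simp [TensorProduct.smul_tmul']

theorem diagCoact_rid (ρ : V →ₗ[k] V ⊗[k] A) (x : V ⊗[k] k) :
    ρ (TensorProduct.rid k V x) = (TensorProduct.rid k V).toLinearMap.rTensor A
      (diagCoact ρ ((TensorProduct.mk k k A).flip 1) x) := by
  induction x with
  | zero => simp
  | add x y hx hy => simp only [map_add, hx, hy]
  | tmul v c =>
  rw [diagCoact_tmul, TensorProduct.rid_tmul, map_smul]
  generalize ρ v = x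
  induction x with
  | zero => simp
  | add x y hx hy => simp only [map_add, TensorProduct.add_tmul, smul_add, hx, hy]
  | tmul v b => simp [TensorProduct.smul_tmul']

end DiagonalCoaction

section Twist
set_option linter.unusedSimpArgs false
variable (k A : Type u) [Field k] [Ring A] [HopfAlgebra k A]

/-- The iterated comultiplication `a ↦ a₍₁₎ ⊗ (a₍₂₎ ⊗ a₍₃₎)`. -/
def comul₃ : A →ₗ[k] A ⊗[k] (A ⊗[k] A) := (comul (R := k) (A := A)).lTensor A ∘ₗ comul

variable {k A}
variable {V W : Type u} [AddCommGroup V] [Module k V] [AddCommGroup W] [Module k W]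

variable {M : Type u} [AddCommGroup M] [Module k M]

/-- For a bilinear map `f : V × M → W`, the linear map
`(v ⊗ b) ⊗ (x ⊗ (m ⊗ z)) ↦ f(v, m) ⊗ S(x) b z`. -/
def adTwist (f : V →ₗ[k] M →ₗ[k] W) :
    (V ⊗[k] A) ⊗[k] (A ⊗[k] (M ⊗[k] A)) →ₗ[k] W ⊗[k] A :=
  TensorProduct.map (TensorProduct.lift f)
      (LinearMap.mul' k A ∘ₗ
        TensorProduct.map (HopfAlgebra.antipode k) (LinearMap.mul' k A) ∘ₗ
        (TensorProduct.leftComm k A A A).toLinearMap) ∘ₗ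
    (TensorProduct.tensorTensorTensorComm k V A M (A ⊗[k] A)).toLinearMap ∘ₗ
    (TensorProduct.leftComm k A M A).toLinearMap.lTensor (V ⊗[k] A)

theorem adTwist_tmul (f : V →ₗ[k] M →ₗ[k] W) (v : V) (b x : A) (m : M) (z : A) :
    adTwist f ((v ⊗ₜ b) ⊗ₜ (x ⊗ₜ (m ⊗ₜ z))) =
      f v m ⊗ₜ[k] (HopfAlgebra.antipode k x * (b * z)) := by
  simp [adTwist]

theorem comul₃_eq_left : comul₃ k A = (TensorProduct.assoc k A A A).toLinearMap ∘ₗ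
    (comul (R := k) (A := A)).rTensor A ∘ₗ comul :=
  Coalgebra.coassoc.symm

theorem comul_four :
    ((comul (R := k) (A := A)).rTensor A).lTensor A ∘ₗ comul₃ k A =
    ((TensorProduct.assoc k A A A).symm.toLinearMap).lTensor A ∘ₗ
    (TensorProduct.assoc k A A (A ⊗[k] A)).toLinearMap ∘ₗ
      TensorProduct.map comul comul ∘ₗ (comul (R := k) (A := A)) := by
  simp only [comul₃, coassoc_simps]

theorem comul_five :
    ((comul₃ k A).rTensor A).lTensor A ∘ₗ comul₃ k A =
    ((TensorProduct.assoc k A (A ⊗[k] A) A).symm.toLinearMap ∘ₗ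
      (TensorProduct.assoc k A A A).symm.toLinearMap.lTensor A).lTensor A ∘ₗ
    (TensorProduct.assoc k A A (A ⊗[k] (A ⊗[k] A))).toLinearMap ∘ₗ
      TensorProduct.map comul ((comul (R := k) (A := A)).lTensor A) ∘ₗ comul₃ k A := by
  simp only [comul₃, coassoc_simps]

theorem comul_three_counit (a : A) :
    TensorProduct.map (counit (R := k)) ((counit (R := k)).lTensor A) (comul₃ k A a) =
      (1 : k) ⊗ₜ[k] (a ⊗ₜ[k] (1 : k)) := by
  have h : TensorProduct.map (counit (R := k)) ((counit (R := k)).lTensor A) (comul₃ k A a) =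
      ((counit (R := k) (A := A)).lTensor A ∘ₗ comul).lTensor k
        ((counit (R := k)).rTensor A (comul a)) := by
    simp only [comul₃, LinearMap.comp_apply]
    generalize comul (R := k) a = x
    induction x with
    | zero => simp
    | add x y hx hy => simp only [map_add, hx, hy]
    | tmul x y => simp
  rw [h]
  simp

theorem comul₃_mul (a b : A) : comul₃ k A (a * b) = comul₃ k A a * comul₃ k A b := by
  simp only [comul₃, LinearMap.comp_apply, Bialgebra.comul_mul]
  generalize comul (R := k) a = x
  generalize comul (R := k) b = y
  induction x with
  | zero => simp
  | add x y hx hy => simp only [map_add, add_mul, hx, hy]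
  | tmul x x' =>
  induction y with
  | zero => simp
  | add x y hx hy => simp only [map_add, mul_add, hx, hy]
  | tmul y y' => simp

theorem comul_antipode (a : A) : comul (R := k) (HopfAlgebra.antipode k a) =
    TensorProduct.map (HopfAlgebra.antipode k) (HopfAlgebra.antipode k)
      (TensorProduct.comm k A A (comul a)) := by
  let F : A →ₗ[k] A ⊗[k] A := comul ∘ₗ HopfAlgebra.antipode k
  let G : A →ₗ[k] A ⊗[k] A := TensorProduct.map (HopfAlgebra.antipode k)
    (HopfAlgebra.antipode k) ∘ₗ (TensorProduct.comm k A A).toLinearMap ∘ₗ comul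
  suffices h : WithConv.toConv G = WithConv.toConv F from
    (LinearMap.congr_fun (WithConv.toConv_injective h) a).symm
  refine left_inv_eq_right_inv (a := WithConv.toConv (comul (R := k) (A := A))) ?_
    LinearMap.comul_right_inv
  apply WithConv.ext
  refine LinearMap.ext fun a => ?_
  rw [LinearMap.convMul_def, LinearMap.convOne_def]
  simp only [LinearMap.comp_apply]
  let Ψ : A ⊗[k] ((A ⊗[k] A) ⊗[k] A) →ₗ[k] A ⊗[k] A :=
    TensorProduct.map (LinearMap.mul' k A ∘ₗ (HopfAlgebra.antipode k).rTensor A)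
        (LinearMap.mul' k A ∘ₗ (HopfAlgebra.antipode k).rTensor A) ∘ₗ
      (TensorProduct.leftComm k A (A ⊗[k] A) A).toLinearMap
  trans Ψ (((comul (R := k) (A := A)).rTensor A).lTensor A (comul₃ k A a))
  · have := LinearMap.congr_fun (comul_four (k := k) (A := A)) a
    simp only [LinearMap.comp_apply] at this
    rw [this]
    generalize comul (R := k) a = x
    induction x with
    | zero => simp
    | add x y hx hy => simp only [map_add, hx, hy]
    | tmul x y =>
      simp only [TensorProduct.map_tmul, G, LinearMap.comp_apply]
      generalize comul (R := k) x = x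
      generalize comul (R := k) y = y
      induction x with
      | zero => simp
      | add x y hx hy => simp only [map_add, TensorProduct.add_tmul, hx, hy]
      | tmul x x' =>
      induction y with
      | zero => simp
      | add x y hx hy => simp only [map_add, TensorProduct.tmul_add, hx, hy]
      | tmul y y' => simp [Ψ]
  · simp only [comul₃, LinearMap.comp_apply]
    trans TensorProduct.mk k A A 1 (LinearMap.mul' k A ((HopfAlgebra.antipode k).rTensor A
      (((TensorProduct.lid k A).toLinearMap ∘ₗ (counit (R := k)).rTensor A ∘ₗ
        comul).lTensor A (comul a))))
    · generalize comul (R := k) a = x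
      induction x with
      | zero => simp
      | add x y hx hy => simp only [map_add, hx, hy]
      | tmul x y =>
        simp only [LinearMap.lTensor_tmul, LinearMap.comp_apply]
        generalize comul (R := k) y = y
        induction y with
        | zero => simp
        | add x y hx hy => simp only [map_add, TensorProduct.tmul_add, hx, hy]
        | tmul y z => simp [Ψ, Algebra.algebraMap_eq_smul_one, TensorProduct.smul_tmul]
    · have h : (TensorProduct.lid k A).toLinearMap ∘ₗ (counit (R := k)).rTensor A ∘ₗ
          comul (R := k) (A := A) = LinearMap.id := LinearMap.ext fun a => by simp
      rw [h]
      simp [Algebra.algebraMap_eq_smul_one, Algebra.TensorProduct.one_def]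

/-- The right coaction `v ⊗ a ↦ (v₍₀₎ ⊗ a₍₂₎) ⊗ S(a₍₁₎) v₍₁₎ a₍₃₎` on `V ⊗ A`. -/
def freeCoact (ρ : V →ₗ[k] V ⊗[k] A) : V ⊗[k] A →ₗ[k] (V ⊗[k] A) ⊗[k] A :=
  adTwist (TensorProduct.mk k V A) ∘ₗ TensorProduct.map ρ (comul₃ k A)

theorem freeCoact_tmul (ρ : V →ₗ[k] V ⊗[k] A) (v : V) (a : A) :
    freeCoact ρ (v ⊗ₜ a) = adTwist (TensorProduct.mk k V A) (ρ v ⊗ₜ comul₃ k A a) :=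
  rfl

theorem freeCoact_counit (ρ : V →ₗ[k] V ⊗[k] A)
    (hρ : ∀ v, TensorProduct.rid k V ((counit (R := k) (A := A)).lTensor V (ρ v)) = v)
    (x : V ⊗[k] A) :
    TensorProduct.rid k (V ⊗[k] A)
      ((counit (R := k) (A := A)).lTensor (V ⊗[k] A) (freeCoact ρ x)) = x := by
  induction x with
  | zero => simp
  | add x y hx hy => simp only [map_add, hx, hy]
  | tmul v a =>
    rw [freeCoact_tmul]
    let Φ : k ⊗[k] (A ⊗[k] k) →ₗ[k] A :=
      (TensorProduct.lid k A).toLinearMap ∘ₗ (TensorProduct.rid k A).toLinearMap.lTensor k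
    trans TensorProduct.rid k V ((counit (R := k) (A := A)).lTensor V (ρ v)) ⊗ₜ[k]
      Φ (TensorProduct.map (counit (R := k)) ((counit (R := k)).lTensor A) (comul₃ k A a))
    · generalize comul₃ k A a = y
      generalize ρ v = x
      induction x with
      | zero => simp
      | add x y hx hy => simp only [map_add, TensorProduct.add_tmul, hx, hy]
      | tmul v b =>
      induction y using triple_induction with
      | zero => simp
      | add x y hx hy => simp only [map_add, TensorProduct.tmul_add, hx, hy]
      | tmul x y z =>
        simp [Φ, adTwist_tmul, TensorProduct.smul_tmul, TensorProduct.tmul_smul, smul_smul,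
          mul_comm, mul_left_comm]
    · rw [hρ, comul_three_counit]
      simp [Φ]

theorem freeCoact_coassoc (ρ : V →ₗ[k] V ⊗[k] A)
    (hρ : ∀ v, TensorProduct.assoc k V A A (ρ.rTensor A (ρ v)) =
      (comul (R := k) (A := A)).lTensor V (ρ v))
    (x : V ⊗[k] A) :
    TensorProduct.assoc k (V ⊗[k] A) A A ((freeCoact ρ).rTensor A (freeCoact ρ x)) =
      (comul (R := k) (A := A)).lTensor (V ⊗[k] A) (freeCoact ρ x) := by
  induction x with
  | zero => simp
  | add x y hx hy => simp only [map_add, hx, hy]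
  | tmul v a =>
    rw [freeCoact_tmul]
    trans TensorProduct.assoc k _ _ _ (adTwist (TensorProduct.curry
      (adTwist (TensorProduct.mk k V A)))
        (ρ.rTensor A (ρ v) ⊗ₜ ((comul₃ k A).rTensor A).lTensor A (comul₃ k A a)))
    · generalize comul₃ k A a = y
      generalize ρ v = x
      induction x with
      | zero => simp
      | add x y hx hy => simp only [map_add, TensorProduct.add_tmul, hx, hy]
      | tmul v b =>
      induction y using triple_induction with
      | zero => simp
      | add x y hx hy => simp only [map_add, TensorProduct.tmul_add, hx, hy]
      | tmul x y z => simp [adTwist_tmul, freeCoact_tmul]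
    · have h1 := (LinearEquiv.eq_symm_apply _).2 (hρ v)
      have h2 := LinearMap.congr_fun (comul_five (k := k) (A := A)) a
      rw [LinearMap.comp_apply] at h2
      rw [h1, h2]
      simp only [LinearMap.comp_apply]
      generalize comul₃ k A a = y
      generalize ρ v = x
      induction x with
      | zero => simp
      | add x y hx hy => simp only [map_add, TensorProduct.add_tmul, hx, hy]
      | tmul v b =>
      induction y using triple_induction with
      | zero => simp
      | add x y hx hy => simp only [map_add, TensorProduct.tmul_add, hx, hy]
      | tmul x y z =>
      simp only [LinearMap.lTensor_tmul, TensorProduct.map_tmul, adTwist_tmul,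
        Bialgebra.comul_mul, comul_antipode]
      generalize comul (R := k) b = b
      generalize comul (R := k) x = x
      generalize comul (R := k) z = z
      induction b with
      | zero => simp
      | add x y hx hy =>
        simp only [map_add, TensorProduct.add_tmul, TensorProduct.tmul_add, mul_add, add_mul,
          hx, hy]
      | tmul b c =>
      induction x with
      | zero => simp
      | add x y hx hy =>
        simp only [map_add, TensorProduct.add_tmul, TensorProduct.tmul_add, mul_add, add_mul,
          hx, hy]
      | tmul x p =>
      induction z with
      | zero => simp
      | add x y hx hy =>
        simp only [map_add, TensorProduct.tmul_add, mul_add, hx, hy]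
      | tmul r z => simp [adTwist_tmul]

/-- The right action `(v ⊗ a) ⊗ b ↦ v ⊗ a b` on `V ⊗ A`. -/
def freeAct : V ⊗[k] A →ₗ[k] A →ₗ[k] V ⊗[k] A :=
  TensorProduct.curry ((LinearMap.mul' k A).lTensor V ∘ₗ
    (TensorProduct.assoc k V A A).toLinearMap)

theorem freeAct_tmul (v : V) (a b : A) : freeAct (v ⊗ₜ[k] a) b = v ⊗ₜ[k] (a * b) := rfl

theorem freeAct_one (x : V ⊗[k] A) : freeAct x 1 = x := by
  induction x with
  | zero => simp
  | add x y hx hy => simp only [map_add, LinearMap.add_apply, hx, hy]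
  | tmul v a => simp [freeAct_tmul]

theorem freeAct_mul (x : V ⊗[k] A) (a b : A) :
    freeAct x (a * b) = freeAct (freeAct x a) b := by
  induction x with
  | zero => simp
  | add x y hx hy => simp only [map_add, LinearMap.add_apply, hx, hy]
  | tmul v c => simp [freeAct_tmul, mul_assoc]

theorem freeCoact_freeAct (ρ : V →ₗ[k] V ⊗[k] A) (x : V ⊗[k] A) (a : A) :
    freeCoact ρ (freeAct x a) = adTwist freeAct (freeCoact ρ x ⊗ₜ comul₃ k A a) := by
  induction x with
  | zero => simp
  | add x y hx hy =>
    simp only [map_add, LinearMap.add_apply, TensorProduct.add_tmul, hx, hy]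
  | tmul v c =>
    rw [freeAct_tmul, freeCoact_tmul, freeCoact_tmul, comul₃_mul]
    generalize ρ v = x
    generalize comul₃ k A a = y
    generalize comul₃ k A c = z
    induction x with
    | zero => simp
    | add x y hx hy => simp only [map_add, TensorProduct.add_tmul, hx, hy]
    | tmul v b =>
    induction y using triple_induction with
    | zero => simp
    | add x y hx hy => simp only [map_add, TensorProduct.tmul_add, mul_add, hx, hy]
    | tmul x y r =>
    induction z using triple_induction with
    | zero => simp
    | add x y hx hy =>
      simp only [map_add, TensorProduct.tmul_add, TensorProduct.add_tmul, add_mul, hx, hy]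
    | tmul x' y' r' =>
      simp [adTwist_tmul, freeAct_tmul, HopfAlgebra.antipode_mul_antidistrib, mul_assoc]

theorem freeCoact_map {V' : Type u} [AddCommGroup V'] [Module k V']
    {ρ : V →ₗ[k] V ⊗[k] A} {ρ' : V' →ₗ[k] V' ⊗[k] A} (f : V →ₗ[k] V')
    (hf : ∀ v, ρ' (f v) = f.rTensor A (ρ v)) (x : V ⊗[k] A) :
    freeCoact ρ' (f.rTensor A x) = (f.rTensor A).rTensor A (freeCoact ρ x) := by
  induction x with
  | zero => simp
  | add x y hx hy => simp only [map_add, hx, hy]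
  | tmul v a =>
    rw [LinearMap.rTensor_tmul, freeCoact_tmul, freeCoact_tmul, hf]
    generalize ρ v = x
    generalize comul₃ k A a = y
    induction x with
    | zero => simp
    | add x y hx hy => simp only [map_add, TensorProduct.add_tmul, hx, hy]
    | tmul v b =>
    induction y using triple_induction with
    | zero => simp
    | add x y hx hy => simp only [map_add, TensorProduct.tmul_add, hx, hy]
    | tmul x y z => simp [adTwist_tmul]

theorem freeAct_map {V' : Type u} [AddCommGroup V'] [Module k V'] (f : V →ₗ[k] V')
    (x : V ⊗[k] A) (a : A) : f.rTensor A (freeAct x a) = freeAct (f.rTensor A x) a := by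
  induction x with
  | zero => simp
  | add x y hx hy => simp only [map_add, LinearMap.add_apply, hx, hy]
  | tmul v c => simp [freeAct_tmul]

/-- The diagonal right action `(v ⊗ w) ⊗ a ↦ v a₍₁₎ ⊗ w a₍₂₎` on `V ⊗ W`. -/
def diagAct (α : V →ₗ[k] A →ₗ[k] V) (β : W →ₗ[k] A →ₗ[k] W) :
    V ⊗[k] W →ₗ[k] A →ₗ[k] V ⊗[k] W :=
  TensorProduct.curry (TensorProduct.map (TensorProduct.lift α) (TensorProduct.lift β) ∘ₗ
    (TensorProduct.tensorTensorTensorComm k V W A A).toLinearMap ∘ₗ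
    (comul (R := k) (A := A)).lTensor (V ⊗[k] W))

theorem diagAct_tmul (α : V →ₗ[k] A →ₗ[k] V) (β : W →ₗ[k] A →ₗ[k] W) (v : V) (w : W) (a : A) :
    diagAct α β (v ⊗ₜ w) a = TensorProduct.map (α v) (β w) (comul a) := by
  simp only [diagAct, TensorProduct.curry_apply, LinearMap.comp_apply, LinearMap.lTensor_tmul]
  generalize comul (R := k) a = x
  induction x with
  | zero => simp
  | add x y hx hy => simp only [map_add, TensorProduct.tmul_add, hx, hy]
  | tmul x y => simp

theorem diagAct_one (α : V →ₗ[k] A →ₗ[k] V) (β : W →ₗ[k] A →ₗ[k] W) (hα : ∀ v, α v 1 = v)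
    (hβ : ∀ w, β w 1 = w) (x : V ⊗[k] W) : diagAct α β x 1 = x := by
  induction x with
  | zero => simp
  | add x y hx hy => simp only [map_add, LinearMap.add_apply, hx, hy]
  | tmul v w => simp [diagAct_tmul, Algebra.TensorProduct.one_def, hα, hβ]

theorem diagAct_mul (α : V →ₗ[k] A →ₗ[k] V) (β : W →ₗ[k] A →ₗ[k] W)
    (hα : ∀ v a b, α v (a * b) = α (α v a) b) (hβ : ∀ w a b, β w (a * b) = β (β w a) b)
    (x : V ⊗[k] W) (a b : A) :
    diagAct α β x (a * b) = diagAct α β (diagAct α β x a) b := by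
  induction x with
  | zero => simp
  | add x y hx hy => simp only [map_add, LinearMap.add_apply, hx, hy]
  | tmul v w =>
    rw [diagAct_tmul, diagAct_tmul, Bialgebra.comul_mul]
    generalize comul (R := k) a = x
    induction x with
    | zero => simp
    | add x y hx hy => simp only [map_add, LinearMap.add_apply, add_mul, hx, hy]
    | tmul x y =>
    rw [TensorProduct.map_tmul, diagAct_tmul]
    generalize comul (R := k) b = z
    induction z with
    | zero => simp
    | add x y hx hy => simp only [map_add, mul_add, hx, hy]
    | tmul z t => simp [hα, hβ]

theorem diagAct_map {V' W' : Type u} [AddCommGroup V'] [Module k V'] [AddCommGroup W'] [Module k W']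
    {α : V →ₗ[k] A →ₗ[k] V} {β : W →ₗ[k] A →ₗ[k] W}
    {α' : V' →ₗ[k] A →ₗ[k] V'} {β' : W' →ₗ[k] A →ₗ[k] W'} (f : V →ₗ[k] V') (g : W →ₗ[k] W')
    (hf : ∀ v a, f (α v a) = α' (f v) a) (hg : ∀ w a, g (β w a) = β' (g w) a)
    (x : V ⊗[k] W) (a : A) :
    TensorProduct.map f g (diagAct α β x a) = diagAct α' β' (TensorProduct.map f g x) a := by
  induction x with
  | zero => simp
  | add x y hx hy => simp only [map_add, LinearMap.add_apply, hx, hy]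
  | tmul v w =>
    rw [TensorProduct.map_tmul, diagAct_tmul, diagAct_tmul]
    generalize comul (R := k) a = x
    induction x with
    | zero => simp
    | add x y hx hy => simp only [map_add, hx, hy]
    | tmul x y => simp [hf, hg]

theorem diagAct_assoc {U : Type u} [AddCommGroup U] [Module k U] (α : U →ₗ[k] A →ₗ[k] U)
    (β : V →ₗ[k] A →ₗ[k] V) (γ : W →ₗ[k] A →ₗ[k] W) (x : (U ⊗[k] V) ⊗[k] W) (a : A) :
    TensorProduct.assoc k U V W (diagAct (diagAct α β) γ x a) =
      diagAct α (diagAct β γ) (TensorProduct.assoc k U V W x) a := by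
  induction x with
  | zero => simp
  | add x y hx hy => simp only [map_add, LinearMap.add_apply, hx, hy]
  | tmul x w =>
  induction x with
  | zero => simp
  | add x y hx hy => simp only [map_add, TensorProduct.add_tmul, LinearMap.add_apply, hx, hy]
  | tmul u v =>
  rw [TensorProduct.assoc_tmul, diagAct_tmul, diagAct_tmul]
  trans TensorProduct.map (α u) (TensorProduct.map (β v) (γ w)) (comul₃ k A a)
  · simp only [comul₃_eq_left, LinearMap.comp_apply]
    generalize comul (R := k) a = x
    induction x with
    | zero => simp
    | add x y hx hy => simp only [map_add, hx, hy]
    | tmul x y =>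
    simp only [TensorProduct.map_tmul, LinearMap.rTensor_tmul, diagAct_tmul]
    generalize comul (R := k) x = x
    induction x with
    | zero => simp
    | add x y hx hy => simp only [map_add, TensorProduct.add_tmul, hx, hy]
    | tmul x z => simp
  · simp only [comul₃, LinearMap.comp_apply]
    generalize comul (R := k) a = x
    induction x with
    | zero => simp
    | add x y hx hy => simp only [map_add, hx, hy]
    | tmul x y => simp [diagAct_tmul]

variable (k A) in
/-- The action of `A` on `k` through the counit. -/
def counitAct : k →ₗ[k] A →ₗ[k] k := (LinearMap.mul k k).compl₂ (counit (R := k) (A := A))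

theorem counitAct_apply (c : k) (a : A) : counitAct k A c a = c * counit (R := k) a := rfl

theorem diagAct_lid (β : V →ₗ[k] A →ₗ[k] V) (x : k ⊗[k] V) (a : A) :
    TensorProduct.lid k V (diagAct (counitAct k A) β x a) = β (TensorProduct.lid k V x) a := by
  induction x with
  | zero => simp
  | add x y hx hy => simp only [map_add, LinearMap.add_apply, hx, hy]
  | tmul c v =>
    rw [diagAct_tmul, TensorProduct.lid_tmul]
    trans c • β v (TensorProduct.lid k A ((counit (R := k)).rTensor A (comul a)))
    · generalize comul (R := k) a = x
      induction x with
      | zero => simp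
      | add x y hx hy => simp only [map_add, smul_add, hx, hy]
      | tmul x y => simp [counitAct_apply, mul_smul]
    · simp

theorem diagAct_rid (α : V →ₗ[k] A →ₗ[k] V) (x : V ⊗[k] k) (a : A) :
    TensorProduct.rid k V (diagAct α (counitAct k A) x a) = α (TensorProduct.rid k V x) a := by
  induction x with
  | zero => simp
  | add x y hx hy => simp only [map_add, LinearMap.add_apply, hx, hy]
  | tmul v c =>
    rw [diagAct_tmul, TensorProduct.rid_tmul]
    trans c • α v (TensorProduct.rid k A ((counit (R := k)).lTensor A (comul a)))
    · generalize comul (R := k) a = x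
      induction x with
      | zero => simp
      | add x y hx hy => simp only [map_add, smul_add, hx, hy]
      | tmul x y => simp [counitAct_apply, mul_smul]
    · simp

theorem counitAct_compat (c : k) (a : A) :
    (TensorProduct.mk k k A).flip 1 (counitAct k A c a) =
      adTwist (counitAct k A) ((TensorProduct.mk k k A).flip 1 c ⊗ₜ comul₃ k A a) := by
  trans TensorProduct.mk k k A c (LinearMap.mul' k A ((HopfAlgebra.antipode k).rTensor A
      (((TensorProduct.lid k A).toLinearMap ∘ₗ (counit (R := k)).rTensor A ∘ₗ
        comul).lTensor A (comul a))))
  · have h : (TensorProduct.lid k A).toLinearMap ∘ₗ (counit (R := k)).rTensor A ∘ₗ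
        comul (R := k) (A := A) = LinearMap.id := LinearMap.ext fun a => by simp
    rw [h]
    simp [counitAct_apply, Algebra.algebraMap_eq_smul_one, TensorProduct.smul_tmul', mul_comm]
  · simp only [comul₃, LinearMap.comp_apply]
    generalize comul (R := k) a = x
    induction x with
    | zero => simp
    | add x y hx hy => simp only [map_add, TensorProduct.tmul_add, hx, hy]
    | tmul x y =>
    simp only [LinearMap.lTensor_tmul, LinearMap.comp_apply]
    generalize comul (R := k) y = y
    induction y with
    | zero => simp
    | add x y hx hy => simp only [map_add, TensorProduct.tmul_add, hx, hy]
    | tmul y z =>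
      simp [adTwist_tmul, counitAct_apply, TensorProduct.smul_tmul', mul_comm]
end Twist

section Compat
set_option linter.unusedSimpArgs false
variable {k A : Type u} [Field k] [Ring A] [HopfAlgebra k A]
variable {V W : Type u} [AddCommGroup V] [Module k V] [AddCommGroup W] [Module k W]

theorem comul_six : TensorProduct.map (comul₃ k A) (comul₃ k A) ∘ₗ comul (R := k) (A := A) =
    (TensorProduct.assoc k A (A ⊗[k] A) (A ⊗[k] (A ⊗[k] A))).symm.toLinearMap ∘ₗ
      ((TensorProduct.assoc k A A (A ⊗[k] (A ⊗[k] A))).symm.toLinearMap ∘ₗ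
        (TensorProduct.assoc k A A (A ⊗[k] A)).toLinearMap.lTensor A).lTensor A ∘ₗ
      (((comul (R := k) (A := A)).rTensor (A ⊗[k] A) ∘ₗ comul₃ k A).lTensor A).lTensor A ∘ₗ
      comul₃ k A := by
  simp only [comul₃, coassoc_simps]

theorem comul_four_left :
    ((comul (R := k) (A := A)).rTensor A).lTensor A ∘ₗ comul₃ k A =
    ((TensorProduct.assoc k A A A).symm.toLinearMap).lTensor A ∘ₗ
      ((comul (R := k) (A := A)).lTensor A).lTensor A ∘ₗ comul₃ k A := by
  simp only [comul₃, coassoc_simps]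

theorem comul₃_collapse (a : A) :
    TensorProduct.lid k (A ⊗[k] A) ((counit (R := k)).rTensor (A ⊗[k] A) (comul₃ k A a)) =
      comul a := by
  trans (comul (R := k) (A := A)) (TensorProduct.lid k A
    ((counit (R := k)).rTensor A (comul a)))
  · simp only [comul₃, LinearMap.comp_apply]
    generalize comul (R := k) a = x
    induction x with
    | zero => simp
    | add x y hx hy => simp only [map_add, hx, hy]
    | tmul x y => simp
  · simp

theorem diag_compat (ρ : V →ₗ[k] V ⊗[k] A) (σ : W →ₗ[k] W ⊗[k] A)
    (α : V →ₗ[k] A →ₗ[k] V) (β : W →ₗ[k] A →ₗ[k] W)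
    (hα : ∀ v a, ρ (α v a) = adTwist α (ρ v ⊗ₜ comul₃ k A a))
    (hβ : ∀ w a, σ (β w a) = adTwist β (σ w ⊗ₜ comul₃ k A a)) (x : V ⊗[k] W) (a : A) :
    diagCoact ρ σ (diagAct α β x a) =
      adTwist (diagAct α β) (diagCoact ρ σ x ⊗ₜ comul₃ k A a) := by
  induction x with
  | zero => simp
  | add x y hx hy => simp only [map_add, LinearMap.add_apply, TensorProduct.add_tmul, hx, hy]
  | tmul v w =>
    rw [diagAct_tmul, diagCoact_tmul]
    let P : (V ⊗[k] A) ⊗[k] (W ⊗[k] A) →ₗ[k] (V ⊗[k] W) ⊗[k] A :=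
      (LinearMap.mul' k A).lTensor (V ⊗[k] W) ∘ₗ
        (TensorProduct.tensorTensorTensorComm k V A W A).toLinearMap
    have e1 : diagCoact ρ σ (TensorProduct.map (α v) (β w) (comul a)) =
        P (TensorProduct.map (adTwist α ∘ₗ TensorProduct.mk k _ _ (ρ v))
          (adTwist β ∘ₗ TensorProduct.mk k _ _ (σ w))
            ((TensorProduct.map (comul₃ k A) (comul₃ k A) ∘ₗ comul (R := k) (A := A)) a)) := by
      simp only [LinearMap.comp_apply (TensorProduct.map (comul₃ k A) (comul₃ k A))]
      generalize comul (R := k) a = x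
      induction x with
      | zero => simp
      | add x y hx hy => simp only [map_add, hx, hy]
      | tmul x y => simp [diagCoact_tmul, hα, hβ, P]
    rw [e1, comul_six]
    generalize ρ v = s
    generalize σ w = t
    induction s with
    | zero => simp
    | add x y hx hy =>
      simp only [map_add, TensorProduct.add_tmul, LinearMap.add_apply, TensorProduct.map_add_left,
        LinearMap.comp_add, hx, hy]
    | tmul v b =>
    induction t with
    | zero => simp
    | add x y hx hy =>
      simp only [map_add, TensorProduct.add_tmul, TensorProduct.tmul_add, LinearMap.add_apply,
        TensorProduct.map_add_right, LinearMap.comp_add, hx, hy]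
    | tmul w c =>
    -- `x ⊗ ((y ⊗ y') ⊗ z) ↦ (v y ⊗ w y') ⊗ S(x) b c z`
    let Ω : A ⊗[k] ((A ⊗[k] A) ⊗[k] A) →ₗ[k] (V ⊗[k] W) ⊗[k] A :=
      adTwist (LinearMap.toSpanSingleton k _ (TensorProduct.map (α v) (β w))) ∘ₗ
        TensorProduct.mk k (k ⊗[k] A) _ (1 ⊗ₜ (b * c))
    have hΩ : ∀ x y y' z, Ω (x ⊗ₜ ((y ⊗ₜ y') ⊗ₜ z)) =
        (α v y ⊗ₜ β w y') ⊗ₜ (HopfAlgebra.antipode k x * (b * (c * z))) := by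
      intro x y y' z
      simp [Ω, adTwist_tmul, mul_assoc]
    trans Ω ((((comul (R := k) (A := A)).rTensor A).lTensor A ∘ₗ comul₃ k A) a)
    · rw [comul_four_left]
      simp only [LinearMap.comp_apply]
      generalize comul₃ k A a = x
      induction x using triple_induction with
      | zero => simp
      | add x y hx hy => simp only [map_add, hx, hy]
      | tmul x y z =>
      simp only [LinearMap.lTensor_tmul, LinearMap.comp_apply]
      rw [← comul₃_collapse z]
      generalize comul₃ k A z = q
      induction q using triple_induction with
      | zero => simp
      | add x y hx hy => simp only [map_add, TensorProduct.tmul_add, hx, hy]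
      | tmul m y' z =>
      trans (α v y ⊗ₜ β w y') ⊗ₜ (HopfAlgebra.antipode k x * (b *
        (LinearMap.mul' k A ((HopfAlgebra.antipode k).lTensor A (comul m)) * (c * z))))
      · rw [LinearMap.rTensor_tmul]
        generalize comul (R := k) m = m
        induction m with
        | zero => simp
        | add x y hx hy =>
          simp only [map_add, TensorProduct.tmul_add, TensorProduct.add_tmul, add_mul, mul_add,
            hx, hy]
        | tmul m n => simp [P, adTwist_tmul, mul_assoc]
      · simp [hΩ, Algebra.algebraMap_eq_smul_one]
    · simp only [LinearMap.comp_apply (((comul (R := k) (A := A)).rTensor A).lTensor A)]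
      generalize comul₃ k A a = x
      induction x using triple_induction with
      | zero => simp
      | add x y hx hy => simp only [map_add, TensorProduct.tmul_add, hx, hy]
      | tmul x y z =>
      simp only [LinearMap.lTensor_tmul, LinearMap.rTensor_tmul, LinearMap.mul'_apply,
        TensorProduct.tensorTensorTensorComm_tmul, adTwist_tmul, diagAct_tmul]
      generalize comul (R := k) y = y
      induction y with
      | zero => simp
      | add x y hx hy => simp only [map_add, TensorProduct.tmul_add, TensorProduct.add_tmul, hx, hy]
      | tmul y y' => simp [hΩ, mul_assoc]
end Compat

section
variable (k A : Type u) [Field k] [Ring A] [HopfAlgebra k A]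

/-- A right `A`-comodule: a vector space with a counital and coassociative coaction
`v ↦ v₍₀₎ ⊗ v₍₁₎`. -/
structure RightComod where
  carrier : Type u
  [addCommGroup : AddCommGroup carrier]
  [module : Module k carrier]
  coact : carrier →ₗ[k] carrier ⊗[k] A
  counit_coact : ∀ v,
    TensorProduct.rid k carrier ((counit (R := k) (A := A)).lTensor carrier (coact v)) = v
  coassoc : ∀ v, TensorProduct.assoc k carrier A A (coact.rTensor A (coact v)) =
      (comul (R := k) (A := A)).lTensor carrier (coact v)

attribute [instance] RightComod.addCommGroup RightComod.module
end

namespace RightComod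
variable {k A : Type u} [Field k] [Ring A] [HopfAlgebra k A]

/-- Morphisms of comodules: colinear maps. -/
@[ext]
structure Hom (V W : RightComod k A) where
  lin : V.carrier →ₗ[k] W.carrier
  colinear : ∀ v, W.coact (lin v) = lin.rTensor A (V.coact v)

instance : Category (RightComod k A) where
  Hom := Hom
  id V := ⟨LinearMap.id, fun v => by simp⟩
  comp f g := ⟨g.lin ∘ₗ f.lin, fun v => by
    simp [g.colinear, f.colinear, LinearMap.rTensor_comp]⟩

@[ext]
theorem hom_ext {V W : RightComod k A} {f g : V ⟶ W} (h : f.lin = g.lin) : f = g := Hom.ext h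

@[simp] theorem id_lin (V : RightComod k A) : Hom.lin (𝟙 V) = LinearMap.id := rfl
@[simp] theorem comp_lin {U V W : RightComod k A} (f : U ⟶ V) (g : V ⟶ W) :
    (f ≫ g).lin = g.lin ∘ₗ f.lin := rfl

instance (V W : RightComod k A) : Zero (V ⟶ W) := ⟨⟨0, fun v => by simp⟩⟩

instance (V W : RightComod k A) : Add (V ⟶ W) :=
  ⟨fun f g => ⟨f.lin + g.lin, fun v => by simp [f.colinear, g.colinear, LinearMap.rTensor_add]⟩⟩

instance (V W : RightComod k A) : Neg (V ⟶ W) :=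
  ⟨fun f => ⟨-f.lin, fun v => by simp [f.colinear, LinearMap.rTensor_neg]⟩⟩

instance (V W : RightComod k A) : AddCommGroup (V ⟶ W) where
  nsmul := nsmulRec
  zsmul := zsmulRec
  add_assoc f g h := Hom.ext (add_assoc f.lin g.lin h.lin)
  zero_add f := Hom.ext (zero_add f.lin)
  add_zero f := Hom.ext (add_zero f.lin)
  add_comm f g := Hom.ext (add_comm f.lin g.lin)
  neg_add_cancel f := Hom.ext (neg_add_cancel f.lin)

@[simp] theorem add_lin {V W : RightComod k A} (f g : V ⟶ W) : (f + g).lin = f.lin + g.lin := rfl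
@[simp] theorem neg_lin {V W : RightComod k A} (f : V ⟶ W) : (-f).lin = -f.lin := rfl

@[simp] theorem zero_lin {V W : RightComod k A} : (0 : V ⟶ W).lin = 0 := rfl

instance (V W : RightComod k A) : Module k (V ⟶ W) where
  smul c f := ⟨c • f.lin, fun v => by simp [f.colinear, LinearMap.rTensor_smul]⟩
  one_smul f := Hom.ext (one_smul k f.lin)
  mul_smul a b f := Hom.ext (mul_smul a b f.lin)
  smul_zero a := Hom.ext (smul_zero a)
  zero_smul f := Hom.ext (zero_smul k f.lin)
  smul_add a f g := Hom.ext (smul_add a f.lin g.lin)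
  add_smul a b f := Hom.ext (add_smul a b f.lin)

@[simp] theorem smul_lin {V W : RightComod k A} (c : k) (f : V ⟶ W) : (c • f).lin = c • f.lin := rfl

instance : Preadditive (RightComod k A) where
  add_comp _ _ _ _ _ _ := hom_ext (LinearMap.comp_add _ _ _)
  comp_add _ _ _ _ _ _ := hom_ext (LinearMap.add_comp _ _ _)

instance : Linear k (RightComod k A) where
  smul_comp _ _ _ _ _ _ := hom_ext (LinearMap.comp_smul _ _ _)
  comp_smul _ _ _ _ _ _ := hom_ext (LinearMap.smul_comp _ _ _)

/-- The tensor product of two right comodules, with the diagonal coaction. -/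
abbrev tensor (V W : RightComod k A) : RightComod k A where
  carrier := V.carrier ⊗[k] W.carrier
  coact := diagCoact V.coact W.coact
  counit_coact := diagCoact_counit V.coact W.coact V.counit_coact W.counit_coact
  coassoc := diagCoact_coassoc V.coact W.coact V.coassoc W.coassoc

variable (k A) in
/-- The trivial comodule `k`, with coaction `1 ↦ 1 ⊗ 1`. -/
abbrev trivial : RightComod k A where
  carrier := k
  coact := (TensorProduct.mk k k A).flip 1
  counit_coact v := by simp
  coassoc v := by simp [Algebra.TensorProduct.one_def]

/-- A colinear linear isomorphism is an isomorphism of comodules. -/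
abbrev isoMk {V W : RightComod k A} (e : V.carrier ≃ₗ[k] W.carrier)
    (h : ∀ v, W.coact (e v) = e.toLinearMap.rTensor A (V.coact v)) : V ≅ W where
  hom := ⟨e.toLinearMap, h⟩
  inv := ⟨e.symm.toLinearMap, fun w => by
    obtain ⟨v, rfl⟩ := e.surjective w
    simp [h, ← LinearMap.rTensor_comp_apply]⟩
  hom_inv_id := hom_ext (by simp)
  inv_hom_id := hom_ext (by simp)

/-- The tensor product of two colinear maps. -/
abbrev tensorMap {V V' W W' : RightComod k A} (f : V ⟶ V') (g : W ⟶ W') :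
    tensor V W ⟶ tensor V' W' :=
  ⟨TensorProduct.map f.lin g.lin, diagCoact_map f.lin g.lin f.colinear g.colinear⟩

/-- The tensor category of right comodules: the diagonal coaction on tensor products, the trivial
comodule as unit, and the constraints of the category of vector spaces. -/
instance : MonoidalCategory (RightComod k A) where
  tensorObj := tensor
  whiskerLeft V _ _ f := tensorMap (𝟙 V) f
  whiskerRight f V := tensorMap f (𝟙 V)
  tensorHom f g := tensorMap f g
  tensorUnit := trivial k A
  associator U V W := isoMk (TensorProduct.assoc k U.carrier V.carrier W.carrier)
    (diagCoact_assoc U.coact V.coact W.coact)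
  leftUnitor V := isoMk (TensorProduct.lid k V.carrier) (diagCoact_lid V.coact)
  rightUnitor V := isoMk (TensorProduct.rid k V.carrier) (diagCoact_rid V.coact)
  tensorHom_def _ _ := hom_ext (TensorProduct.ext' fun _ _ => rfl)
  id_tensorHom_id _ _ := hom_ext (TensorProduct.ext' fun _ _ => rfl)
  tensorHom_comp_tensorHom _ _ _ _ := hom_ext (TensorProduct.ext' fun _ _ => rfl)
  whiskerLeft_id _ _ := hom_ext (TensorProduct.ext' fun _ _ => rfl)
  id_whiskerRight _ _ := hom_ext (TensorProduct.ext' fun _ _ => rfl)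
  associator_naturality _ _ _ := hom_ext (TensorProduct.ext_threefold fun _ _ _ => rfl)
  leftUnitor_naturality f := hom_ext (TensorProduct.ext' fun c v => (f.lin.map_smul c v).symm)
  rightUnitor_naturality f := hom_ext (TensorProduct.ext' fun v c => (f.lin.map_smul c v).symm)
  pentagon _ _ _ _ := hom_ext (TensorProduct.ext_fourfold fun _ _ _ _ => rfl)
  triangle _ _ := hom_ext (TensorProduct.ext_threefold fun v c w =>
    (TensorProduct.smul_tmul (R := k) c v w).symm)

end RightComod

section
variable (k A : Type u) [Field k] [Ring A] [HopfAlgebra k A]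

/-- A (right-right) Yetter–Drinfeld module over `A`: a right `A`-comodule with a right `A`-module
structure `act v a = v ← a` such that
`(v ← a)₍₀₎ ⊗ (v ← a)₍₁₎ = v₍₀₎ ← a₍₂₎ ⊗ S(a₍₁₎) v₍₁₎ a₍₃₎`. -/
structure YetterDrinfeld extends RightComod k A where
  act : carrier →ₗ[k] A →ₗ[k] carrier
  act_one : ∀ v, act v 1 = v
  act_mul : ∀ v a b, act v (a * b) = act (act v a) b
  compat : ∀ v a, coact (act v a) = adTwist act (coact v ⊗ₜ comul₃ k A a)

end

namespace YetterDrinfeld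
variable {k A : Type u} [Field k] [Ring A] [HopfAlgebra k A]

/-- Morphisms of Yetter–Drinfeld modules: `A`-linear and `A`-colinear maps. -/
@[ext]
structure Hom (V W : YetterDrinfeld k A) where
  hom : V.toRightComod ⟶ W.toRightComod
  map_act : ∀ v a, hom.lin (V.act v a) = W.act (hom.lin v) a

instance : Category (YetterDrinfeld k A) where
  Hom := Hom
  id V := ⟨𝟙 V.toRightComod, fun _ _ => rfl⟩
  comp f g := ⟨f.hom ≫ g.hom, fun v a => by simp [f.map_act, g.map_act]⟩

/-- The linear map underlying a morphism of Yetter–Drinfeld modules. -/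
abbrev Hom.lin {V W : YetterDrinfeld k A} (f : V ⟶ W) : V.carrier →ₗ[k] W.carrier :=
  RightComod.Hom.lin (Hom.hom f)

@[ext]
theorem hom_ext {V W : YetterDrinfeld k A} {f g : V ⟶ W} (h : Hom.lin f = Hom.lin g) : f = g :=
  Hom.ext (RightComod.hom_ext h)

@[simp] theorem id_hom (V : YetterDrinfeld k A) : Hom.hom (𝟙 V) = 𝟙 V.toRightComod := rfl

@[simp] theorem comp_hom {U V W : YetterDrinfeld k A} (f : U ⟶ V) (g : V ⟶ W) :
    Hom.hom (f ≫ g) = Hom.hom f ≫ Hom.hom g := rfl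

instance (V W : YetterDrinfeld k A) : Zero (V ⟶ W) := ⟨⟨0, fun v a => by simp⟩⟩

instance (V W : YetterDrinfeld k A) : Add (V ⟶ W) :=
  ⟨fun f g => ⟨f.hom + g.hom, fun v a => by simp [f.map_act, g.map_act]⟩⟩

instance (V W : YetterDrinfeld k A) : Neg (V ⟶ W) :=
  ⟨fun f => ⟨-f.hom, fun v a => by simp [f.map_act]⟩⟩

instance (V W : YetterDrinfeld k A) : AddCommGroup (V ⟶ W) where
  nsmul := nsmulRec
  zsmul := zsmulRec
  add_assoc f g h := Hom.ext (add_assoc f.hom g.hom h.hom)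
  zero_add f := Hom.ext (zero_add f.hom)
  add_zero f := Hom.ext (add_zero f.hom)
  add_comm f g := Hom.ext (add_comm f.hom g.hom)
  neg_add_cancel f := Hom.ext (neg_add_cancel f.hom)

@[simp] theorem add_hom {V W : YetterDrinfeld k A} (f g : V ⟶ W) :
    Hom.hom (f + g) = Hom.hom f + Hom.hom g := rfl

@[simp] theorem zero_hom {V W : YetterDrinfeld k A} : Hom.hom (0 : V ⟶ W) = 0 := rfl

instance (V W : YetterDrinfeld k A) : Module k (V ⟶ W) where
  smul c f := ⟨c • f.hom, fun v a => by simp [f.map_act]⟩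
  one_smul f := Hom.ext (one_smul k f.hom)
  mul_smul a b f := Hom.ext (mul_smul a b f.hom)
  smul_zero a := Hom.ext (smul_zero a)
  zero_smul f := Hom.ext (zero_smul k f.hom)
  smul_add a f g := Hom.ext (smul_add a f.hom g.hom)
  add_smul a b f := Hom.ext (add_smul a b f.hom)

@[simp] theorem smul_hom {V W : YetterDrinfeld k A} (c : k) (f : V ⟶ W) :
    Hom.hom (c • f) = c • Hom.hom f := rfl

instance : Preadditive (YetterDrinfeld k A) where
  add_comp _ _ _ _ _ _ := hom_ext (LinearMap.comp_add _ _ _)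
  comp_add _ _ _ _ _ _ := hom_ext (LinearMap.add_comp _ _ _)

instance : Linear k (YetterDrinfeld k A) where
  smul_comp _ _ _ _ _ _ := hom_ext (LinearMap.comp_smul _ _ _)
  comp_smul _ _ _ _ _ _ := hom_ext (LinearMap.smul_comp _ _ _)

/-- The tensor product of Yetter–Drinfeld modules: diagonal coaction and diagonal action. -/
abbrev tensor (V W : YetterDrinfeld k A) : YetterDrinfeld k A where
  toRightComod := RightComod.tensor V.toRightComod W.toRightComod
  act := diagAct V.act W.act
  act_one := diagAct_one V.act W.act V.act_one W.act_one
  act_mul := diagAct_mul V.act W.act V.act_mul W.act_mul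
  compat := diag_compat V.coact W.coact V.act W.act V.compat W.compat

variable (k A) in
/-- The trivial Yetter–Drinfeld module `k`: coaction `1 ↦ 1 ⊗ 1` and action through the counit. -/
abbrev trivial : YetterDrinfeld k A where
  toRightComod := RightComod.trivial k A
  act := counitAct k A
  act_one c := by simp [counitAct_apply]
  act_mul c a b := by simp [counitAct_apply, mul_assoc]
  compat := counitAct_compat

/-- An isomorphism of comodules that is `A`-linear is an isomorphism of Yetter–Drinfeld modules. -/
abbrev isoMk {V W : YetterDrinfeld k A} (e : V.toRightComod ≅ W.toRightComod)
    (h : ∀ v a, e.hom.lin (V.act v a) = W.act (e.hom.lin v) a) : V ≅ W where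
  hom := ⟨e.hom, h⟩
  inv := ⟨e.inv, fun w a => by
    have h1 : ∀ v, e.inv.lin (e.hom.lin v) = v := fun v =>
      LinearMap.congr_fun (congrArg RightComod.Hom.lin e.hom_inv_id) v
    have h2 : ∀ v, e.hom.lin (e.inv.lin v) = v := fun v =>
      LinearMap.congr_fun (congrArg RightComod.Hom.lin e.inv_hom_id) v
    rw [← h1 (V.act _ a), h, h2]⟩
  hom_inv_id := Hom.ext e.hom_inv_id
  inv_hom_id := Hom.ext e.inv_hom_id

/-- The tensor product of two morphisms. -/
abbrev tensorMap {V V' W W' : YetterDrinfeld k A} (f : V ⟶ V') (g : W ⟶ W') :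
    tensor V W ⟶ tensor V' W' :=
  ⟨RightComod.tensorMap f.hom g.hom, diagAct_map (Hom.lin f) (Hom.lin g) f.map_act g.map_act⟩

/-- The tensor category of Yetter–Drinfeld modules, with the constraints of the category of
vector spaces. -/
instance : MonoidalCategory (YetterDrinfeld k A) where
  tensorObj := tensor
  whiskerLeft V _ _ f := tensorMap (𝟙 V) f
  whiskerRight f V := tensorMap f (𝟙 V)
  tensorHom f g := tensorMap f g
  tensorUnit := trivial k A
  associator U V W := isoMk
    (RightComod.isoMk (TensorProduct.assoc k U.carrier V.carrier W.carrier)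
      (diagCoact_assoc U.coact V.coact W.coact))
    (diagAct_assoc U.act V.act W.act)
  leftUnitor V := isoMk
    (RightComod.isoMk (TensorProduct.lid k V.carrier) (diagCoact_lid V.coact)) (diagAct_lid V.act)
  rightUnitor V := isoMk
    (RightComod.isoMk (TensorProduct.rid k V.carrier) (diagCoact_rid V.coact)) (diagAct_rid V.act)
  tensorHom_def _ _ := hom_ext (TensorProduct.ext' fun _ _ => rfl)
  id_tensorHom_id _ _ := hom_ext (TensorProduct.ext' fun _ _ => rfl)
  tensorHom_comp_tensorHom _ _ _ _ := hom_ext (TensorProduct.ext' fun _ _ => rfl)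
  whiskerLeft_id _ _ := hom_ext (TensorProduct.ext' fun _ _ => rfl)
  id_whiskerRight _ _ := hom_ext (TensorProduct.ext' fun _ _ => rfl)
  associator_naturality _ _ _ := hom_ext (TensorProduct.ext_threefold fun _ _ _ => rfl)
  leftUnitor_naturality f :=
    hom_ext (TensorProduct.ext' fun c v => ((Hom.lin f).map_smul c v).symm)
  rightUnitor_naturality f :=
    hom_ext (TensorProduct.ext' fun v c => ((Hom.lin f).map_smul c v).symm)
  pentagon _ _ _ _ := hom_ext (TensorProduct.ext_fourfold fun _ _ _ _ => rfl)
  triangle _ _ := hom_ext (TensorProduct.ext_threefold fun v c w =>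
    (TensorProduct.smul_tmul (R := k) c v w).symm)

variable (k A) in
/-- The forgetful functor from Yetter–Drinfeld modules to right comodules. -/
def forget : YetterDrinfeld k A ⥤ RightComod k A where
  obj V := V.toRightComod
  map f := Hom.hom f

/-- The forgetful functor is a strict tensor functor. -/
instance : (forget k A).Monoidal :=
  Functor.CoreMonoidal.toMonoidal
    { εIso := Iso.refl _
      μIso := fun _ _ => Iso.refl _
      μIso_hom_natural_left := fun _ _ =>
        RightComod.hom_ext (TensorProduct.ext' fun _ _ => rfl)
      μIso_hom_natural_right := fun _ _ =>
        RightComod.hom_ext (TensorProduct.ext' fun _ _ => rfl)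
      associativity := fun _ _ _ =>
        RightComod.hom_ext (TensorProduct.ext_threefold fun _ _ _ => rfl)
      left_unitality := fun _ => RightComod.hom_ext (TensorProduct.ext' fun _ _ => rfl)
      right_unitality := fun _ => RightComod.hom_ext (TensorProduct.ext' fun _ _ => rfl) }

/-- The Yetter–Drinfeld module `V ⊠ A`: the space `V ⊗ A` with action by right multiplication on
`A` and coaction `v ⊗ a ↦ v₍₀₎ ⊗ a₍₂₎ ⊗ S(a₍₁₎) v₍₁₎ a₍₃₎`. -/
abbrev free (V : RightComod k A) : YetterDrinfeld k A where
  carrier := V.carrier ⊗[k] A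
  coact := freeCoact V.coact
  counit_coact := freeCoact_counit V.coact V.counit_coact
  coassoc := freeCoact_coassoc V.coact V.coassoc
  act := freeAct
  act_one := freeAct_one
  act_mul := freeAct_mul
  compat := freeCoact_freeAct V.coact

variable (k A) in
/-- The functor `V ↦ V ⊠ A`, `f ↦ f ⊗ id`. -/
def freeFunctor : RightComod k A ⥤ YetterDrinfeld k A where
  obj V := free V
  map f := ⟨⟨f.lin.rTensor A, freeCoact_map f.lin f.colinear⟩, freeAct_map f.lin⟩
  map_id _ := hom_ext (TensorProduct.ext' fun _ _ => rfl)
  map_comp _ _ := hom_ext (TensorProduct.ext' fun _ _ => rfl)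

/-- A Yetter–Drinfeld module is free if it is isomorphic to `V ⊠ A` for a right comodule `V`. -/
def IsFree (X : YetterDrinfeld k A) : Prop :=
  ∃ V : RightComod k A, Nonempty (X ≅ (freeFunctor k A).obj V)

/-- A complex `⋯ → P₂ → P₁ → P₀ → 0` is a free Yetter–Drinfeld resolution of `M` if all `Pₙ` are
free and there is a morphism `η : P₀ → M` of Yetter–Drinfeld modules for which
`⋯ → P₂ → P₁ → P₀ → M → 0` is an exact sequence (of vector spaces). -/
structure IsFreeResolution (P : ChainComplex (YetterDrinfeld k A) ℕ) (M : YetterDrinfeld k A) :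
    Prop where
  free : ∀ n, IsFree (P.X n)
  exact_succ : ∀ n, Function.Exact (Hom.lin (P.d (n + 2) (n + 1))) (Hom.lin (P.d (n + 1) n))
  augmentation : ∃ η : P.X 0 ⟶ M,
    Function.Exact (Hom.lin (P.d 1 0)) (Hom.lin η) ∧ Function.Surjective (Hom.lin η)

/-- The length of a complex: the supremum in `ℕ ∪ {∞}` of the degrees of its nonzero terms. -/
def length (P : ChainComplex (YetterDrinfeld k A) ℕ) : ℕ∞ :=
  ⨆ (n : ℕ) (_ : Nontrivial (P.X n).carrier), (n : ℕ∞)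

end YetterDrinfeld

end

noncomputable section

section LaxHalfBraiding
open MonoidalCategory

universe v₁ v₂ u₁ u₂
variable {C : Type u₁} [Category.{v₁} C] [MonoidalCategory C]
  {D : Type u₂} [Category.{v₂} D] [MonoidalCategory D]

/-- A half-braiding on `V`, not required to be invertible. -/
@[ext]
structure LaxHalfBraiding (V : C) where
  β : ∀ X : C, V ⊗ X ⟶ X ⊗ V
  naturality : ∀ {X Y : C} (f : X ⟶ Y), V ◁ f ≫ β Y = β X ≫ f ▷ V
  unit : β (𝟙_ C) = (ρ_ V).hom ≫ (λ_ V).inv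
  tensor : ∀ X Y : C, β (X ⊗ Y) =
    (α_ V X Y).inv ≫ β X ▷ Y ≫ (α_ X V Y).hom ≫ X ◁ β Y ≫ (α_ X Y V).inv

namespace LaxHalfBraiding

/-- A morphism is compatible with two half-braidings. -/
def Compatible {V W : C} (b : LaxHalfBraiding V) (c : LaxHalfBraiding W) (f : V ⟶ W) : Prop :=
  ∀ X : C, f ▷ X ≫ c.β X = b.β X ≫ X ◁ f

/-- The half-braiding `d` on `V ⊗ W` is the tensor product of the half-braidings `b` and `c`. -/
def IsTensor {V W : C} (b : LaxHalfBraiding V) (c : LaxHalfBraiding W)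
    (d : LaxHalfBraiding (V ⊗ W)) : Prop :=
  ∀ X : C, d.β X = (α_ V W X).hom ≫ V ◁ c.β X ≫ (α_ V X W).inv ≫ b.β X ▷ W ≫ (α_ X V W).hom

/-- The half-braiding transported along an isomorphism. -/
def ofIso {V W : C} (b : LaxHalfBraiding V) (i : V ≅ W) : LaxHalfBraiding W where
  β X := i.inv ▷ X ≫ b.β X ≫ X ◁ i.hom
  naturality f := by
    rw [whisker_exchange_assoc, reassoc_of% b.naturality f, Category.assoc, Category.assoc,
      whisker_exchange]
  unit := by
    rw [b.unit]
    simp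
  tensor X Y := by
    rw [b.tensor]
    simp

theorem ofIso_compatible {V W : C} (b : LaxHalfBraiding V) (i : V ≅ W) :
    Compatible b (b.ofIso i) i.hom := by
  intro X
  simp [ofIso]

section Functor
open Functor.LaxMonoidal Functor.OplaxMonoidal Functor.Monoidal
variable (F : C ⥤ D) [F.Monoidal]

/-- The image under `F` of a component of a half-braiding. -/
def mapβ {V : C} (b : LaxHalfBraiding V) (Z : C) : F.obj V ⊗ F.obj Z ⟶ F.obj Z ⊗ F.obj V :=
  μ F V Z ≫ F.map (b.β Z) ≫ δ F Z V

theorem mapβ_naturality {V : C} (b : LaxHalfBraiding V) {Y Z : C} (f : Y ⟶ Z) :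
    F.obj V ◁ F.map f ≫ mapβ F b Z = mapβ F b Y ≫ F.map f ▷ F.obj V := by
  simp only [mapβ, Category.assoc]
  rw [δ_natural_left, μ_natural_right_assoc, ← F.map_comp_assoc, b.naturality,
    F.map_comp_assoc]

theorem mapβ_unit {V : C} (b : LaxHalfBraiding V) :
    F.obj V ◁ ε F ≫ mapβ F b (𝟙_ C) ≫ η F ▷ F.obj V =
      (ρ_ (F.obj V)).hom ≫ (λ_ (F.obj V)).inv := by
  simp [mapβ, b.unit]

theorem mapβ_tensor {V : C} (b : LaxHalfBraiding V) (X Y : C) :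
    F.obj V ◁ μ F X Y ≫ mapβ F b (X ⊗ Y) ≫ δ F X Y ▷ F.obj V =
      (α_ _ _ _).inv ≫ mapβ F b X ▷ F.obj Y ≫ (α_ _ _ _).hom ≫ F.obj X ◁ mapβ F b Y ≫
        (α_ _ _ _).inv := by
  simp only [mapβ, b.tensor, Functor.map_comp, map_whiskerLeft, map_whiskerRight,
    map_associator, map_associator_inv, Category.assoc, comp_whiskerRight,
    MonoidalCategory.whiskerLeft_comp, μ_δ, μ_δ_assoc,
    whiskerRight_μ_δ, whiskerLeft_μ_δ_assoc,
    Category.comp_id]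

theorem mapβ_compatible {V W : C} {b : LaxHalfBraiding V} {c : LaxHalfBraiding W} {f : V ⟶ W}
    (h : Compatible b c f) (Z : C) :
    F.map f ▷ F.obj Z ≫ mapβ F c Z = mapβ F b Z ≫ F.obj Z ◁ F.map f := by
  simp only [mapβ, Category.assoc]
  rw [δ_natural_right, μ_natural_left_assoc, ← F.map_comp_assoc, h, F.map_comp_assoc]

theorem mapβ_isTensor {V W : C} {b : LaxHalfBraiding V} {c : LaxHalfBraiding W}
    {d : LaxHalfBraiding (V ⊗ W)} (h : IsTensor b c d) (X : C) :
    μ F V W ▷ F.obj X ≫ mapβ F d X ≫ F.obj X ◁ δ F V W =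
      (α_ _ _ _).hom ≫ F.obj V ◁ mapβ F c X ≫ (α_ _ _ _).inv ≫ mapβ F b X ▷ F.obj W ≫
        (α_ _ _ _).hom := by
  simp only [mapβ, h X, Functor.map_comp, map_whiskerLeft, map_whiskerRight,
    map_associator, map_associator_inv, Category.assoc, comp_whiskerRight,
    MonoidalCategory.whiskerLeft_comp, μ_δ, μ_δ_assoc, whiskerRight_μ_δ_assoc, whiskerLeft_μ_δ,
    Category.comp_id]

/-- A half-braiding on `F.obj V` restricts along a fully faithful tensor functor `F`. -/
def preimage [F.Full] [F.Faithful] {V : C} (c : LaxHalfBraiding (F.obj V)) :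
    LaxHalfBraiding V where
  β X := F.preimage (δ F V X ≫ c.β (F.obj X) ≫ μ F X V)
  naturality f := F.map_injective (by
    simp only [Functor.map_comp, Functor.map_preimage, Category.assoc]
    rw [← μ_natural_left, ← δ_natural_right_assoc, reassoc_of% c.naturality])
  unit := F.map_injective (by
    have h : c.β (F.obj (𝟙_ C)) = F.obj V ◁ η F ≫ c.β (𝟙_ D) ≫ ε F ▷ F.obj V := by
      rw [reassoc_of% c.naturality]
      simp [← comp_whiskerRight]
    simp [h, c.unit])
  tensor X Y := F.map_injective (by
    have h : c.β (F.obj (X ⊗ Y)) =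
        F.obj V ◁ δ F X Y ≫ c.β (F.obj X ⊗ F.obj Y) ≫ μ F X Y ▷ F.obj V := by
      rw [reassoc_of% c.naturality]
      simp [← comp_whiskerRight]
    simp only [h, c.tensor, Functor.map_preimage, Functor.map_comp, map_whiskerLeft,
      map_whiskerRight, map_associator, map_associator_inv, Category.assoc, comp_whiskerRight,
      MonoidalCategory.whiskerLeft_comp, μ_δ_assoc, whiskerRight_μ_δ_assoc, whiskerLeft_μ_δ_assoc])

theorem mapβ_preimage [F.Full] [F.Faithful] {V : C} (c : LaxHalfBraiding (F.obj V)) (Z : C) :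
    mapβ F (c.preimage F) Z = c.β (F.obj Z) := by
  simp [mapβ, preimage]

omit [MonoidalCategory C] [F.Monoidal] in
theorem natural_family_ext [F.EssSurj] {V W : D} {p q : ∀ X : D, V ⊗ X ⟶ X ⊗ W}
    (hp : ∀ {X Y : D} (f : X ⟶ Y), V ◁ f ≫ p Y = p X ≫ f ▷ W)
    (hq : ∀ {X Y : D} (f : X ⟶ Y), V ◁ f ≫ q Y = q X ≫ f ▷ W)
    (h : ∀ Z : C, p (F.obj Z) = q (F.obj Z)) (X : D) : p X = q X := by
  have e := F.objObjPreimageIso X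
  rw [← cancel_epi (V ◁ e.hom), hp, hq, h]

variable [F.IsEquivalence]

/-- The components of the half-braiding on `F.obj V` induced by one on `V`. -/
def transportβ {V : C} (b : LaxHalfBraiding V) (X : D) : F.obj V ⊗ X ⟶ X ⊗ F.obj V :=
  F.obj V ◁ (F.objObjPreimageIso X).inv ≫ mapβ F b (F.objPreimage X) ≫
    (F.objObjPreimageIso X).hom ▷ F.obj V

theorem transportβ_comp {V : C} (b : LaxHalfBraiding V) {X : D} {Z : C} (f : X ⟶ F.obj Z) :
    F.obj V ◁ f ≫ mapβ F b Z = transportβ F b X ≫ f ▷ F.obj V := by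
  obtain ⟨g, hg⟩ := F.map_surjective ((F.objObjPreimageIso X).hom ≫ f)
  have : f = (F.objObjPreimageIso X).inv ≫ F.map g := by simp [hg]
  rw [this, MonoidalCategory.whiskerLeft_comp, Category.assoc, mapβ_naturality]
  simp [transportβ]

theorem transportβ_obj {V : C} (b : LaxHalfBraiding V) (Z : C) :
    transportβ F b (F.obj Z) = mapβ F b Z := by
  simpa using (transportβ_comp F b (𝟙 (F.obj Z))).symm

theorem transportβ_eq {V : C} (b : LaxHalfBraiding V) {X : D} {Z : C} (i : X ≅ F.obj Z) :
    transportβ F b X = F.obj V ◁ i.hom ≫ mapβ F b Z ≫ i.inv ▷ F.obj V := by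
  rw [← Category.assoc, transportβ_comp]
  simp

/-- The half-braiding on `F.obj V` induced by one on `V`, for an equivalence `F`. -/
def transport {V : C} (b : LaxHalfBraiding V) : LaxHalfBraiding (F.obj V) where
  β := transportβ F b
  naturality {X Y} f := by
    rw [← cancel_mono ((F.objObjPreimageIso Y).inv ▷ F.obj V), Category.assoc, Category.assoc,
      ← comp_whiskerRight, ← transportβ_comp, ← transportβ_comp]
    simp
  unit := by
    rw [transportβ_eq F b (εIso F)]
    exact mapβ_unit F b
  tensor X Y := by
    rw [transportβ_eq F b
      (((F.objObjPreimageIso X).symm ⊗ᵢ (F.objObjPreimageIso Y).symm) ≪≫ μIso F _ _)]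
    have h := mapβ_tensor F b (F.objPreimage X) (F.objPreimage Y)
    simp only [Iso.trans_hom, Iso.trans_inv, μIso_hom, μIso_inv, comp_whiskerRight,
      MonoidalCategory.whiskerLeft_comp, Category.assoc]
    rw [reassoc_of% h]
    simp only [transportβ]
    simp [MonoidalCategory.tensorHom_def]
    rw [associator_inv_naturality_right_assoc, whisker_exchange_assoc,
      associator_naturality_right_assoc, ← associator_inv_naturality_left_assoc,
      Iso.inv_hom_id_assoc, whisker_exchange_assoc, whisker_exchange_assoc,
      associator_naturality_left_assoc]

theorem transport_β_obj {V : C} (b : LaxHalfBraiding V) (Z : C) :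
    (transport F b).β (F.obj Z) = mapβ F b Z :=
  transportβ_obj F b Z

theorem transport_compatible {V W : C} {b : LaxHalfBraiding V} {c : LaxHalfBraiding W}
    {f : V ⟶ W} (h : Compatible b c f) : Compatible (transport F b) (transport F c) (F.map f) := by
  refine natural_family_ext F (fun g => ?_) (fun g => ?_) fun Z => ?_
  · rw [whisker_exchange_assoc, naturality, Category.assoc]
  · rw [reassoc_of% (transport F b).naturality g, Category.assoc, whisker_exchange]
  · rw [transport_β_obj, transport_β_obj, mapβ_compatible F h]

theorem compatible_of_transport {V W : C} {b : LaxHalfBraiding V} {c : LaxHalfBraiding W}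
    {f : V ⟶ W} (h : Compatible (transport F b) (transport F c) (F.map f)) :
    Compatible b c f := by
  intro Z
  apply F.map_injective
  have := h (F.obj Z)
  simp only [transport_β_obj, mapβ, Category.assoc] at this
  rw [δ_natural_right, μ_natural_left_assoc, ← F.map_comp_assoc, ← F.map_comp_assoc,
    cancel_epi, cancel_mono] at this
  exact this

theorem transport_preimage {V : C} (c : LaxHalfBraiding (F.obj V)) :
    transport F (c.preimage F) = c := by
  apply LaxHalfBraiding.ext
  funext X
  refine natural_family_ext F (naturality _) (naturality _) (fun Z => ?_) X
  rw [transport_β_obj, mapβ_preimage]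

theorem transport_μ_compatible {V W : C} {b : LaxHalfBraiding V} {c : LaxHalfBraiding W}
    {d : LaxHalfBraiding (V ⊗ W)} (h : IsTensor b c d)
    {d' : LaxHalfBraiding (F.obj V ⊗ F.obj W)}
    (h' : IsTensor (transport F b) (transport F c) d') :
    Compatible d' (transport F d) (μ F V W) := by
  refine natural_family_ext F (fun g => ?_) (fun g => ?_) fun Z => ?_
  · rw [whisker_exchange_assoc, naturality, Category.assoc]
  · rw [reassoc_of% d'.naturality g, Category.assoc, whisker_exchange]
  · rw [← cancel_mono (F.obj Z ◁ δ F V W), Category.assoc, transport_β_obj, mapβ_isTensor F h,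
      h' (F.obj Z)]
    simp [transport_β_obj]

theorem transport_ε_compatible {b : LaxHalfBraiding (𝟙_ C)}
    (h : ∀ X, b.β X = (λ_ X).hom ≫ (ρ_ X).inv)
    {b' : LaxHalfBraiding (𝟙_ D)} (h' : ∀ X, b'.β X = (λ_ X).hom ≫ (ρ_ X).inv) :
    Compatible b' (transport F b) (ε F) := by
  refine natural_family_ext F (fun g => ?_) (fun g => ?_) fun Z => ?_
  · rw [whisker_exchange_assoc, naturality, Category.assoc]
  · rw [reassoc_of% b'.naturality g, Category.assoc, whisker_exchange]
  · rw [transport_β_obj, mapβ, h, h']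
    simp

end Functor

end LaxHalfBraiding
end LaxHalfBraiding

section Braid
variable {k A : Type u} [Field k] [Ring A] [HopfAlgebra k A]
variable {V X Y : Type u} [AddCommGroup V] [Module k V] [AddCommGroup X] [Module k X]
  [AddCommGroup Y] [Module k Y]

/-- The map `V ⊗ X → X ⊗ V`, `v ⊗ x ↦ x₍₀₎ ⊗ v x₍₁₎`. -/
def braid (ρ : X →ₗ[k] X ⊗[k] A) (α : V →ₗ[k] A →ₗ[k] V) : V ⊗[k] X →ₗ[k] X ⊗[k] V :=
  TensorProduct.lift (LinearMap.lcomp k _ ρ ∘ₗ LinearMap.lTensorHom X ∘ₗ α)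

theorem braid_tmul (ρ : X →ₗ[k] X ⊗[k] A) (α : V →ₗ[k] A →ₗ[k] V) (v : V) (x : X) :
    braid ρ α (v ⊗ₜ x) = (α v).lTensor X (ρ x) :=
  rfl

variable (k A V) in
/-- The map `a ⊗ (v ⊗ b) ↦ v ⊗ a b`. -/
def leftMul : A ⊗[k] (V ⊗[k] A) →ₗ[k] V ⊗[k] A :=
  (LinearMap.mul' k A).lTensor V ∘ₗ (TensorProduct.leftComm k A V A).toLinearMap

@[simp]
theorem leftMul_tmul (a : A) (v : V) (b : A) :
    leftMul k A V (a ⊗ₜ (v ⊗ₜ b)) = v ⊗ₜ (a * b) := by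
  simp [leftMul]

theorem leftMul_leftMul (a b : A) (w : V ⊗[k] A) :
    leftMul k A V (a ⊗ₜ leftMul k A V (b ⊗ₜ w)) = leftMul k A V ((a * b) ⊗ₜ w) := by
  induction w with
  | zero => simp
  | add x y hx hy => simp only [map_add, TensorProduct.tmul_add, hx, hy]
  | tmul v c => simp [mul_assoc]

theorem leftMul_one (w : V ⊗[k] A) : leftMul k A V (1 ⊗ₜ w) = w := by
  induction w with
  | zero => simp
  | add x y hx hy => simp only [map_add, TensorProduct.tmul_add, hx, hy]
  | tmul v c => simp

/-- The map `(v ⊗ b) ⊗ (x ⊗ y) ↦ v x ⊗ b y`. -/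
def codiag (α : V →ₗ[k] A →ₗ[k] V) : (V ⊗[k] A) ⊗[k] (A ⊗[k] A) →ₗ[k] V ⊗[k] A :=
  TensorProduct.map (TensorProduct.lift α) (LinearMap.mul' k A) ∘ₗ
    (TensorProduct.tensorTensorTensorComm k V A A A).toLinearMap

@[simp]
theorem codiag_tmul (α : V →ₗ[k] A →ₗ[k] V) (v : V) (b x y : A) :
    codiag α ((v ⊗ₜ b) ⊗ₜ (x ⊗ₜ y)) = α v x ⊗ₜ[k] (b * y) := by
  simp [codiag]

/-- The Yetter–Drinfeld condition without antipode:
`(v a₍₂₎)₍₀₎ ⊗ a₍₁₎ (v a₍₂₎)₍₁₎ = v₍₀₎ a₍₁₎ ⊗ v₍₁₎ a₍₂₎`. -/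
def IsCrossed (ρ : V →ₗ[k] V ⊗[k] A) (α : V →ₗ[k] A →ₗ[k] V) : Prop :=
  ∀ v a, leftMul k A V ((ρ ∘ₗ α v).lTensor A (comul a)) = codiag α (ρ v ⊗ₜ comul a)

theorem lTensor_comul₃_comp_comul : (comul₃ k A).lTensor A ∘ₗ comul (R := k) (A := A) =
    (TensorProduct.assoc k A A (A ⊗[k] A)).toLinearMap ∘ₗ
      TensorProduct.map comul comul ∘ₗ comul (R := k) (A := A) := by
  simp only [comul₃, coassoc_simps]

theorem isCrossed_of_compat {ρ : V →ₗ[k] V ⊗[k] A} {α : V →ₗ[k] A →ₗ[k] V}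
    (h : ∀ v a, ρ (α v a) = adTwist α (ρ v ⊗ₜ comul₃ k A a)) : IsCrossed ρ α := by
  intro v a
  have h1 : ρ ∘ₗ α v = (adTwist α ∘ₗ TensorProduct.mk k _ _ (ρ v)) ∘ₗ comul₃ k A :=
    LinearMap.ext fun a => h v a
  have h2 := LinearMap.congr_fun (lTensor_comul₃_comp_comul (k := k) (A := A)) a
  simp only [LinearMap.comp_apply] at h2
  rw [h1, LinearMap.lTensor_comp_apply, h2]
  trans codiag α (ρ v ⊗ₜ comul (TensorProduct.lid k A ((counit (R := k)).rTensor A (comul a))))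
  · generalize ρ v = w
    generalize comul (R := k) a = t
    induction t with
    | zero => simp
    | add x y hx hy => simp only [map_add, TensorProduct.tmul_add, hx, hy]
    | tmul x y =>
    induction w with
    | zero => simp
    | add x y hx hy =>
      simp only [map_add, TensorProduct.add_tmul, LinearMap.comp_add, LinearMap.lTensor_add,
        LinearMap.add_apply, hx, hy]
    | tmul w b =>
    simp only [TensorProduct.map_tmul, LinearMap.rTensor_tmul, TensorProduct.lid_tmul, map_smul]
    generalize comul (R := k) y = t
    induction t with
    | zero => simp
    | add x y hx hy => simp only [map_add, TensorProduct.tmul_add, smul_add, hx, hy]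
    | tmul r s =>
    trans α w r ⊗ₜ (LinearMap.mul' k A ((HopfAlgebra.antipode k).lTensor A (comul x)) * (b * s))
    · generalize comul (R := k) x = t
      induction t with
      | zero => simp
      | add x y hx hy =>
        simp only [map_add, TensorProduct.tmul_add, TensorProduct.add_tmul, add_mul, hx, hy]
      | tmul p q => simp [adTwist_tmul, mul_assoc]
    · simp [Algebra.algebraMap_eq_smul_one]
  · simp

theorem IsCrossed.compat {ρ : V →ₗ[k] V ⊗[k] A} {α : V →ₗ[k] A →ₗ[k] V}
    (h : IsCrossed ρ α) (v : V) (a : A) :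
    ρ (α v a) = adTwist α (ρ v ⊗ₜ comul₃ k A a) := by
  have h1 : (leftMul k A V ∘ₗ (ρ ∘ₗ α v).lTensor A) ∘ₗ comul (R := k) (A := A) =
      (codiag α ∘ₗ TensorProduct.mk k _ _ (ρ v)) ∘ₗ comul (R := k) (A := A) :=
    LinearMap.ext fun a => h v a
  have h2 := congrArg (fun f => leftMul k A V
    ((HopfAlgebra.antipode k).rTensor _ (LinearMap.lTensor A f (comul a)))) h1
  have h3 : ∀ f : A ⊗[k] A →ₗ[k] V ⊗[k] A,
      (f ∘ₗ comul).lTensor A (comul a) = f.lTensor A (comul₃ k A a) :=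
    fun f => LinearMap.lTensor_comp_apply _ _ _ _
  simp only [h3] at h2
  trans leftMul k A V ((HopfAlgebra.antipode k).rTensor _
      ((codiag α ∘ₗ TensorProduct.mk k _ _ (ρ v)).lTensor A (comul₃ k A a)))
  · rw [← h2, comul₃_eq_left]
    trans (ρ ∘ₗ α v) (TensorProduct.lid k A ((counit (R := k)).rTensor A (comul a)))
    · simp
    simp only [LinearMap.comp_apply (TensorProduct.assoc k A A A).toLinearMap,
      LinearMap.comp_apply (LinearMap.rTensor A comul)]
    generalize ρ ∘ₗ α v = f
    generalize comul (R := k) a = t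
    induction t with
    | zero => simp
    | add x y hx hy => simp only [map_add, hx, hy]
    | tmul x y =>
    trans leftMul k A V
      (LinearMap.mul' k A ((HopfAlgebra.antipode k).rTensor A (comul x)) ⊗ₜ f y)
    · rw [HopfAlgebra.mul_antipode_rTensor_comul_apply, Algebra.algebraMap_eq_smul_one,
        ← TensorProduct.smul_tmul', map_smul, leftMul_one]
      simp
    rw [LinearMap.rTensor_tmul]
    generalize comul (R := k) x = t
    induction t with
    | zero => simp
    | add x y hx hy => simp only [map_add, TensorProduct.add_tmul, hx, hy]
    | tmul p q => simp [leftMul_leftMul]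
  · generalize ρ v = w
    generalize comul₃ k A a = t
    induction t using triple_induction with
    | zero => simp
    | add x y hx hy => simp only [map_add, TensorProduct.tmul_add, hx, hy]
    | tmul x y z =>
    induction w with
    | zero => simp
    | add x y hx hy =>
      simp only [map_add, TensorProduct.add_tmul, LinearMap.comp_add, LinearMap.lTensor_add,
        LinearMap.add_apply, hx, hy]
    | tmul w b => simp [adTwist_tmul]

theorem braid_colinear {ρ : V →ₗ[k] V ⊗[k] A} {α : V →ₗ[k] A →ₗ[k] V} (h : IsCrossed ρ α)
    {σ : X →ₗ[k] X ⊗[k] A} (hσ : ∀ x, TensorProduct.assoc k X A A (σ.rTensor A (σ x)) =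
      (comul (R := k) (A := A)).lTensor X (σ x)) (t : V ⊗[k] X) :
    diagCoact σ ρ (braid σ α t) = (braid σ α).rTensor A (diagCoact ρ σ t) := by
  induction t with
  | zero => simp
  | add x y hx hy => simp only [map_add, hx, hy]
  | tmul v x =>
  trans (TensorProduct.assoc k X V A).symm ((leftMul k A V ∘ₗ (ρ ∘ₗ α v).lTensor A).lTensor X
    (TensorProduct.assoc k X A A (σ.rTensor A (σ x))))
  · rw [braid_tmul]
    generalize σ x = t
    induction t with
    | zero => simp
    | add x y hx hy => simp only [map_add, hx, hy]
    | tmul x a =>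
    simp only [LinearMap.lTensor_tmul, LinearMap.rTensor_tmul, diagCoact_tmul]
    generalize σ x = t
    induction t with
    | zero => simp
    | add x y hx hy => simp only [map_add, TensorProduct.add_tmul, hx, hy]
    | tmul x b =>
    simp only [TensorProduct.assoc_tmul, LinearMap.lTensor_tmul, LinearMap.comp_apply]
    generalize ρ (α v a) = t
    induction t with
    | zero => simp
    | add x y hx hy => simp only [map_add, TensorProduct.tmul_add, hx, hy]
    | tmul w c => simp
  · rw [hσ, ← LinearMap.lTensor_comp_apply]
    have h1 : (leftMul k A V ∘ₗ (ρ ∘ₗ α v).lTensor A) ∘ₗ comul (R := k) (A := A) =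
        (codiag α ∘ₗ TensorProduct.mk k _ _ (ρ v)) ∘ₗ comul (R := k) (A := A) :=
      LinearMap.ext fun a => h v a
    rw [h1, LinearMap.lTensor_comp_apply, ← hσ, diagCoact_tmul]
    generalize σ x = t
    generalize ρ v = w
    induction t with
    | zero => simp
    | add x y hx hy => simp only [map_add, TensorProduct.tmul_add, hx, hy]
    | tmul x a =>
    induction w with
    | zero => simp
    | add x y hx hy =>
      simp only [map_add, TensorProduct.add_tmul, LinearMap.comp_add, LinearMap.lTensor_add,
        LinearMap.add_apply, hx, hy]
    | tmul w b =>
    simp only [TensorProduct.tensorTensorTensorComm_tmul, LinearMap.lTensor_tmul,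
      LinearMap.rTensor_tmul, braid_tmul]
    generalize σ x = t
    induction t with
    | zero => simp
    | add x y hx hy => simp only [map_add, TensorProduct.add_tmul, hx, hy]
    | tmul x c => simp

theorem braid_natural (α : V →ₗ[k] A →ₗ[k] V) {σ : X →ₗ[k] X ⊗[k] A} {τ : Y →ₗ[k] Y ⊗[k] A}
    (f : X →ₗ[k] Y) (hf : ∀ x, τ (f x) = f.rTensor A (σ x)) (v : V) (x : X) :
    braid τ α (v ⊗ₜ f x) = f.rTensor V (braid σ α (v ⊗ₜ x)) := by
  rw [braid_tmul, braid_tmul, hf]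
  generalize σ x = t
  induction t with
  | zero => simp
  | add x y hx hy => simp only [map_add, hx, hy]
  | tmul x a => simp

theorem braid_diagCoact {α : V →ₗ[k] A →ₗ[k] V} (hα : ∀ v a b, α v (a * b) = α (α v a) b)
    (σ : X →ₗ[k] X ⊗[k] A) (τ : Y →ₗ[k] Y ⊗[k] A) (v : V) (x : X) (y : Y) :
    braid (diagCoact σ τ) α (v ⊗ₜ (x ⊗ₜ y)) = (TensorProduct.assoc k X Y V).symm
      ((braid τ α).lTensor X (TensorProduct.assoc k X V Y (braid σ α (v ⊗ₜ x) ⊗ₜ y))) := by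
  simp only [braid_tmul, diagCoact_tmul]
  generalize σ x = t
  induction t with
  | zero => simp
  | add x y hx hy => simp only [map_add, TensorProduct.add_tmul, hx, hy]
  | tmul x a =>
  simp only [LinearMap.lTensor_tmul, TensorProduct.assoc_tmul, braid_tmul]
  generalize τ y = t
  induction t with
  | zero => simp
  | add x y hx hy => simp only [map_add, TensorProduct.tmul_add, hx, hy]
  | tmul y b => simp [hα]

theorem braid_diagAct {W : Type u} [AddCommGroup W] [Module k W] (α : V →ₗ[k] A →ₗ[k] V)
    (β : W →ₗ[k] A →ₗ[k] W)
    {σ : X →ₗ[k] X ⊗[k] A} (hσ : ∀ x, TensorProduct.assoc k X A A (σ.rTensor A (σ x)) =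
      (comul (R := k) (A := A)).lTensor X (σ x)) (v : V) (w : W) (x : X) :
    braid σ (diagAct α β) ((v ⊗ₜ w) ⊗ₜ x) = TensorProduct.assoc k X V W ((braid σ α).rTensor W
      ((TensorProduct.assoc k V X W).symm (v ⊗ₜ braid σ β (w ⊗ₜ x)))) := by
  trans (TensorProduct.map (α v) (β w)).lTensor X ((comul (R := k) (A := A)).lTensor X (σ x))
  · rw [braid_tmul, ← LinearMap.lTensor_comp_apply]
    congr 2
    exact LinearMap.ext fun a => diagAct_tmul α β v w a
  rw [← hσ, braid_tmul]
  generalize σ x = t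
  induction t with
  | zero => simp
  | add x y hx hy => simp only [map_add, TensorProduct.tmul_add, hx, hy]
  | tmul x a =>
  simp only [LinearMap.lTensor_tmul, TensorProduct.assoc_symm_tmul, LinearMap.rTensor_tmul,
    braid_tmul]
  generalize σ x = t
  induction t with
  | zero => simp
  | add x y hx hy => simp only [map_add, TensorProduct.add_tmul, hx, hy]
  | tmul x b => simp

end Braid

section HalfBraiding
open MonoidalCategory
variable {k A : Type u} [Field k] [Ring A] [HopfAlgebra k A]

namespace RightComod

/-- The cofree comodule `M ⊗ A` on a vector space `M`. -/
abbrev cofree (A : Type u) [Ring A] [HopfAlgebra k A] (M : Type u) [AddCommGroup M] [Module k M] :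
    RightComod k A where
  carrier := M ⊗[k] A
  coact := (TensorProduct.assoc k M A A).symm.toLinearMap ∘ₗ comul.lTensor M
  counit_coact t := by
    trans ((TensorProduct.rid k A).toLinearMap ∘ₗ (counit (R := k)).lTensor A ∘ₗ
      comul (R := k) (A := A)).lTensor M t
    · induction t with
      | zero => simp
      | add x y hx hy => simp only [map_add, hx, hy]
      | tmul m a =>
        simp only [LinearMap.lTensor_tmul, LinearMap.comp_apply]
        generalize comul (R := k) a = x
        induction x with
        | zero => simp
        | add x y hx hy => simp only [map_add, TensorProduct.tmul_add, hx, hy]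
        | tmul x y => simp
    · have h : (TensorProduct.rid k A).toLinearMap ∘ₗ (counit (R := k)).lTensor A ∘ₗ
          comul (R := k) (A := A) = LinearMap.id := LinearMap.ext fun a => by simp
      rw [h]
      simp
  coassoc t := by
    trans (TensorProduct.assoc k M A (A ⊗[k] A)).symm ((comul₃ k A).lTensor M t)
    · rw [comul₃_eq_left]
      induction t with
      | zero => simp
      | add x y hx hy => simp only [map_add, hx, hy]
      | tmul m a =>
        simp only [LinearMap.lTensor_tmul, LinearMap.comp_apply]
        generalize comul (R := k) a = x
        induction x with
        | zero => simp
        | add x y hx hy => simp only [map_add, TensorProduct.tmul_add, hx, hy]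
        | tmul x y =>
          simp only [LinearEquiv.coe_coe, TensorProduct.assoc_symm_tmul, LinearMap.rTensor_tmul,
            LinearMap.comp_apply, LinearMap.lTensor_tmul]
          generalize comul (R := k) x = x
          induction x with
          | zero => simp
          | add x y hx hy =>
            simp only [map_add, TensorProduct.tmul_add, TensorProduct.add_tmul, hx, hy]
          | tmul x z => simp
    · induction t with
      | zero => simp
      | add x y hx hy => simp only [map_add, hx, hy]
      | tmul m a =>
        simp only [LinearMap.lTensor_tmul, comul₃, LinearMap.comp_apply]
        generalize comul (R := k) a = x
        induction x with
        | zero => simp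
        | add x y hx hy => simp only [map_add, TensorProduct.tmul_add, hx, hy]
        | tmul x y => simp

variable (k A) in
/-- The regular comodule. -/
abbrev regular : RightComod k A where
  carrier := A
  coact := comul
  counit_coact a := by simp
  coassoc a := by simp

/-- The coaction of a comodule as a morphism to a cofree comodule. -/
abbrev toCofree (X : RightComod k A) : X ⟶ cofree A X.carrier where
  lin := X.coact
  colinear x := by
    rw [LinearMap.comp_apply, ← X.coassoc]
    simp

/-- The morphism `a ↦ m ⊗ a` from the regular comodule to a cofree comodule. -/
abbrev regularToCofree {M : Type u} [AddCommGroup M] [Module k M] (m : M) :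
    regular k A ⟶ cofree A M where
  lin := TensorProduct.mk k M A m
  colinear a := by
    simp only [LinearMap.comp_apply, TensorProduct.mk_apply, LinearMap.lTensor_tmul]
    generalize comul (R := k) a = x
    induction x with
    | zero => simp
    | add x y hx hy => simp only [map_add, TensorProduct.tmul_add, hx, hy]
    | tmul x y => simp

end RightComod

open RightComod

namespace LaxHalfBraiding
variable {V : RightComod k A} (b : LaxHalfBraiding V)

/-- The linear map underlying a component of a half-braiding. -/
def lin (X : RightComod k A) : V.carrier ⊗[k] X.carrier →ₗ[k] X.carrier ⊗[k] V.carrier :=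
  RightComod.Hom.lin (b.β X)

theorem lin_natural {X Y : RightComod k A} (f : X ⟶ Y) (v : V.carrier) (x : X.carrier) :
    b.lin Y (v ⊗ₜ f.lin x) = f.lin.rTensor V.carrier (b.lin X (v ⊗ₜ x)) :=
  LinearMap.congr_fun (congrArg RightComod.Hom.lin (b.naturality f)) (v ⊗ₜ x)

/-- The action `v a = (ε ⊗ id) β(v ⊗ a)` defined by a half-braiding. -/
def act : V.carrier →ₗ[k] A →ₗ[k] V.carrier :=
  TensorProduct.curry ((TensorProduct.lid k V.carrier).toLinearMap ∘ₗ
    (counit (R := k) (A := A)).rTensor V.carrier ∘ₗ b.lin (regular k A))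

theorem act_apply (v : V.carrier) (a : A) : b.act v a = TensorProduct.lid k V.carrier
    ((counit (R := k) (A := A)).rTensor V.carrier (b.lin (regular k A) (v ⊗ₜ a))) :=
  rfl

theorem lin_cofree {M : Type u} [AddCommGroup M] [Module k M] (v : V.carrier) (m : M) (a : A) :
    b.lin (cofree A M) (v ⊗ₜ (m ⊗ₜ[k] a)) =
      (TensorProduct.mk k M A m).rTensor V.carrier (b.lin (regular k A) (v ⊗ₜ a)) :=
  b.lin_natural (regularToCofree m) v a

theorem lin_eq_braid (X : RightComod k A) : b.lin X = braid X.coact b.act := by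
  refine TensorProduct.ext' fun v x => ?_
  rw [braid_tmul]
  have h := b.lin_natural (toCofree X) v x
  let Q : (X.carrier ⊗[k] A) →ₗ[k] X.carrier := (TensorProduct.rid k X.carrier).toLinearMap ∘ₗ
    (counit (R := k) (A := A)).lTensor X.carrier
  have hQ : Q ∘ₗ X.coact = LinearMap.id := LinearMap.ext X.counit_coact
  have h1 := congrArg (Q.rTensor V.carrier) h
  rw [← LinearMap.rTensor_comp_apply, hQ, LinearMap.rTensor_id, LinearMap.id_apply] at h1
  rw [← h1]
  change (Q.rTensor V.carrier) (b.lin (cofree A X.carrier) (v ⊗ₜ X.coact x)) = _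
  generalize X.coact x = t
  induction t with
  | zero => simp
  | add x y hx hy => simp only [map_add, TensorProduct.tmul_add, hx, hy]
  | tmul x a =>
  rw [lin_cofree, LinearMap.lTensor_tmul, act_apply]
  generalize b.lin (regular k A) (v ⊗ₜ a) = t
  induction t with
  | zero => simp
  | add x y hx hy => simp only [map_add, TensorProduct.tmul_add, hx, hy]
  | tmul a v => simp [Q, TensorProduct.smul_tmul]

theorem act_one (v : V.carrier) : b.act v 1 = v := by
  have h : b.lin (𝟙_ (RightComod k A)) (v ⊗ₜ (1 : k)) = (1 : k) ⊗ₜ[k] v :=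
    (LinearMap.congr_fun (congrArg RightComod.Hom.lin b.unit) (v ⊗ₜ (1 : k))).trans (by
      change (1 : k) ⊗ₜ[k] ((1 : k) • v) = _
      rw [one_smul])
  rw [lin_eq_braid] at h
  have h1 := congrArg (TensorProduct.lid k V.carrier) h
  change TensorProduct.lid k V.carrier ((1 : k) ⊗ₜ[k] b.act v 1) = _ at h1
  simpa using h1

theorem act_mul (v : V.carrier) (a c : A) : b.act v (a * c) = b.act (b.act v a) c := by
  have h : b.lin (regular k A ⊗ regular k A) (v ⊗ₜ (a ⊗ₜ[k] c)) =
      (TensorProduct.assoc k A A V.carrier).symm ((b.lin (regular k A)).lTensor A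
        (TensorProduct.assoc k A V.carrier A (b.lin (regular k A) (v ⊗ₜ a) ⊗ₜ c))) :=
    LinearMap.congr_fun (congrArg RightComod.Hom.lin
      (b.tensor (regular k A) (regular k A))) (v ⊗ₜ (a ⊗ₜ[k] c))
  rw [lin_eq_braid, lin_eq_braid] at h
  change braid (diagCoact comul comul) b.act (v ⊗ₜ (a ⊗ₜ[k] c)) = _ at h
  have h1 := congrArg (fun t => TensorProduct.lid k V.carrier
    ((counit (R := k) (A := A)).rTensor V.carrier (TensorProduct.lid k (A ⊗[k] V.carrier)
      ((counit (R := k) (A := A)).rTensor (A ⊗[k] V.carrier)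
        (TensorProduct.assoc k A A V.carrier t))))) h
  have e : ∀ (w : V.carrier) (t : A ⊗[k] A), TensorProduct.lid k V.carrier
      ((counit (R := k) (A := A)).rTensor V.carrier ((b.act w).lTensor A t)) =
      b.act w (TensorProduct.lid k A ((counit (R := k) (A := A)).rTensor A t)) := by
    intro w t
    induction t with
    | zero => simp
    | add x y hx hy => simp only [map_add, hx, hy]
    | tmul x y => simp
  trans b.act v (TensorProduct.lid k A ((counit (R := k) (A := A)).rTensor A (comul a)) *
    TensorProduct.lid k A ((counit (R := k) (A := A)).rTensor A (comul c)))
  · simp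
  trans b.act (b.act v (TensorProduct.lid k A ((counit (R := k) (A := A)).rTensor A (comul a))))
    (TensorProduct.lid k A ((counit (R := k) (A := A)).rTensor A (comul c)))
  swap
  · simp
  refine Eq.trans ?_ (h1.trans ?_)
  · simp only [braid_tmul, diagCoact_tmul]
    generalize comul (R := k) a = s
    generalize comul (R := k) c = t
    induction s with
    | zero => simp
    | add x y hx hy => simp only [map_add, TensorProduct.add_tmul, add_mul, hx, hy]
    | tmul x y =>
    induction t with
    | zero => simp
    | add x y hx hy => simp only [map_add, TensorProduct.tmul_add, mul_add, hx, hy]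
    | tmul z t => simp [smul_comm (counit (R := k) z)]
  · simp only [braid_tmul, LinearEquiv.apply_symm_apply]
    generalize comul (R := k) a = s
    induction s with
    | zero => simp
    | add x y hx hy => simp only [map_add, LinearMap.add_apply, TensorProduct.add_tmul, hx, hy]
    | tmul x y =>
      simp only [LinearMap.lTensor_tmul, TensorProduct.assoc_tmul, LinearMap.rTensor_tmul,
        TensorProduct.lid_tmul, map_smul, braid_tmul, e, LinearMap.smul_apply]

theorem isCrossed : IsCrossed V.coact b.act := by
  intro v a
  have h := (b.β (regular k A)).colinear (v ⊗ₜ a)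
  change diagCoact comul V.coact (b.lin (regular k A) (v ⊗ₜ a)) =
    (b.lin (regular k A)).rTensor A (diagCoact V.coact comul (v ⊗ₜ a)) at h
  have h1 := congrArg (((TensorProduct.lid k V.carrier).toLinearMap ∘ₗ
    (counit (R := k) (A := A)).rTensor V.carrier).rTensor A) h
  refine Eq.trans ?_ (h1.trans ?_)
  · rw [lin_eq_braid, braid_tmul]
    generalize comul (R := k) a = t
    induction t with
    | zero => simp
    | add x y hx hy => simp only [map_add, hx, hy]
    | tmul x y =>
    trans leftMul k A V.carrier
      (TensorProduct.lid k A ((counit (R := k)).rTensor A (comul x)) ⊗ₜ V.coact (b.act v y))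
    · simp
    simp only [LinearMap.lTensor_tmul, diagCoact_tmul]
    generalize comul (R := k) x = t
    generalize V.coact (b.act v y) = w
    induction t with
    | zero => simp
    | add x y hx hy => simp only [map_add, TensorProduct.add_tmul, hx, hy]
    | tmul x y =>
    induction w with
    | zero => simp
    | add x y hx hy => simp only [map_add, TensorProduct.tmul_add, hx, hy]
    | tmul w z => simp [TensorProduct.smul_tmul']
  · rw [← LinearMap.rTensor_comp_apply, diagCoact_tmul]
    generalize comul (R := k) a = t
    generalize V.coact v = w
    induction t with
    | zero => simp
    | add x y hx hy => simp only [map_add, TensorProduct.tmul_add, hx, hy]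
    | tmul x y =>
    induction w with
    | zero => simp
    | add x y hx hy => simp only [map_add, TensorProduct.add_tmul, hx, hy]
    | tmul w z => simp [act_apply]

/-- The Yetter–Drinfeld module defined by a comodule with a half-braiding. -/
abbrev toYetterDrinfeld : YetterDrinfeld k A where
  toRightComod := V
  act := b.act
  act_one := b.act_one
  act_mul := b.act_mul
  compat := b.isCrossed.compat

end LaxHalfBraiding

namespace YetterDrinfeld

/-- The half-braiding `v ⊗ x ↦ x₍₀₎ ⊗ v x₍₁₎` of a Yetter–Drinfeld module. -/
def halfBraiding (V : YetterDrinfeld k A) : LaxHalfBraiding V.toRightComod where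
  β X := ⟨braid X.coact V.act, braid_colinear (isCrossed_of_compat V.compat) X.coassoc⟩
  naturality f := RightComod.hom_ext (TensorProduct.ext' fun v x =>
    braid_natural V.act f.lin f.colinear v x)
  unit := RightComod.hom_ext (TensorProduct.ext' fun v c => by
    change c ⊗ₜ[k] V.act v 1 = 1 ⊗ₜ[k] (c • v)
    rw [V.act_one, TensorProduct.tmul_smul, TensorProduct.smul_tmul']
    simp)
  tensor X Y := RightComod.hom_ext (TensorProduct.ext (LinearMap.ext fun v =>
    TensorProduct.ext' fun x y => braid_diagCoact V.act_mul X.coact Y.coact v x y))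

theorem lid_braid_comul {V : Type u} [AddCommGroup V] [Module k V] (α : V →ₗ[k] A →ₗ[k] V)
    (v : V) (a : A) : TensorProduct.lid k V ((counit (R := k) (A := A)).rTensor V
      (braid comul α (v ⊗ₜ a))) = α v a := by
  trans α v (TensorProduct.lid k A ((counit (R := k) (A := A)).rTensor A (comul a)))
  · rw [braid_tmul]
    generalize comul (R := k) a = t
    induction t with
    | zero => simp
    | add x y hx hy => simp only [map_add, hx, hy]
    | tmul x y => simp
  · simp

theorem halfBraiding_toYetterDrinfeld {V : RightComod k A} (b : LaxHalfBraiding V) :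
    halfBraiding b.toYetterDrinfeld = b :=
  LaxHalfBraiding.ext (funext fun X => RightComod.hom_ext (b.lin_eq_braid X).symm)

theorem compatible {V W : YetterDrinfeld k A} (f : V ⟶ W) :
    V.halfBraiding.Compatible W.halfBraiding (Hom.hom f) := fun X =>
  RightComod.hom_ext (TensorProduct.ext' fun v x => by
    change braid X.coact W.act (Hom.lin f v ⊗ₜ x) =
      (Hom.lin f).lTensor X.carrier (braid X.coact V.act (v ⊗ₜ x))
    rw [braid_tmul, braid_tmul, ← LinearMap.lTensor_comp_apply]
    congr 2
    exact LinearMap.ext fun a => (f.map_act v a).symm)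

theorem map_act_of_compatible {V W : YetterDrinfeld k A} {f : V.toRightComod ⟶ W.toRightComod}
    (h : V.halfBraiding.Compatible W.halfBraiding f) (v : V.carrier) (a : A) :
    f.lin (V.act v a) = W.act (f.lin v) a := by
  have h1 : braid comul W.act (f.lin v ⊗ₜ a) = f.lin.lTensor A (braid comul V.act (v ⊗ₜ a)) :=
    LinearMap.congr_fun (congrArg RightComod.Hom.lin (h (regular k A))) (v ⊗ₜ a)
  rw [← lid_braid_comul W.act, h1, ← lid_braid_comul V.act]
  generalize braid comul V.act (v ⊗ₜ a) = t
  induction t with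
  | zero => simp
  | add x y hx hy => simp only [map_add, hx, hy]
  | tmul x y => simp

theorem isTensor_halfBraiding (V W : YetterDrinfeld k A) :
    V.halfBraiding.IsTensor W.halfBraiding (halfBraiding (V ⊗ W)) := fun X =>
  RightComod.hom_ext (TensorProduct.ext_threefold fun v w x =>
    braid_diagAct V.act W.act X.coassoc v w x)

theorem halfBraiding_unit_β (X : RightComod k A) :
    (halfBraiding (𝟙_ (YetterDrinfeld k A))).β X = (λ_ X).hom ≫ (ρ_ X).inv :=
  RightComod.hom_ext (TensorProduct.ext' fun c x => by
    change braid X.coact (counitAct k A) (c ⊗ₜ x) = (c • x) ⊗ₜ[k] (1 : k)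
    rw [braid_tmul]
    conv_rhs => rw [← X.counit_coact x]
    generalize X.coact x = t
    induction t with
    | zero => simp
    | add x y hx hy => simp only [map_add, smul_add, TensorProduct.add_tmul, hx, hy]
    | tmul x y => simp [counitAct_apply, smul_smul, TensorProduct.smul_tmul])

end YetterDrinfeld
end HalfBraiding

namespace RightComod
variable {k A : Type u} [Field k] [Ring A] [HopfAlgebra k A]

/-- A subspace stable under the coaction is a comodule. -/
abbrev ofInjective (V : RightComod k A) {M : Type u} [AddCommGroup M] [Module k M]
    (i : M →ₗ[k] V.carrier) (hi : Function.Injective i) (c : M →ₗ[k] M ⊗[k] A)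
    (hc : ∀ m, V.coact (i m) = i.rTensor A (c m)) : RightComod k A where
  carrier := M
  coact := c
  counit_coact m := by
    apply hi
    rw [← V.counit_coact (i m), hc]
    generalize c m = t
    induction t with
    | zero => simp
    | add x y hx hy => simp only [map_add, hx, hy]
    | tmul m a => simp
  coassoc m := by
    apply Module.Flat.rTensor_preserves_injective_linearMap (M := A ⊗[k] A) i hi
    trans (comul (R := k) (A := A)).lTensor V.carrier (V.coact (i m))
    · rw [← V.coassoc, hc]
      generalize c m = t
      induction t with
      | zero => simp
      | add x y hx hy => simp only [map_add, hx, hy]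
      | tmul m a =>
        simp only [LinearMap.rTensor_tmul, hc]
        generalize c m = t
        induction t with
        | zero => simp
        | add x y hx hy => simp only [map_add, TensorProduct.add_tmul, hx, hy]
        | tmul m b => simp
    · rw [hc]
      generalize c m = t
      induction t with
      | zero => simp
      | add x y hx hy => simp only [map_add, hx, hy]
      | tmul m a => simp

/-- A quotient space to which the coaction descends is a comodule. -/
abbrev ofSurjective (V : RightComod k A) {M : Type u} [AddCommGroup M] [Module k M]
    (p : V.carrier →ₗ[k] M) (hp : Function.Surjective p) (c : M →ₗ[k] M ⊗[k] A)
    (hc : ∀ v, c (p v) = p.rTensor A (V.coact v)) : RightComod k A where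
  carrier := M
  coact := c
  counit_coact m := by
    obtain ⟨v, rfl⟩ := hp m
    conv_rhs => rw [← V.counit_coact v]
    rw [hc]
    generalize V.coact v = t
    induction t with
    | zero => simp
    | add x y hx hy => simp only [map_add, hx, hy]
    | tmul m a => simp
  coassoc m := by
    obtain ⟨v, rfl⟩ := hp m
    trans p.rTensor (A ⊗[k] A) (TensorProduct.assoc k _ A A (V.coact.rTensor A (V.coact v)))
    · rw [hc]
      generalize V.coact v = t
      induction t with
      | zero => simp
      | add x y hx hy => simp only [map_add, hx, hy]
      | tmul m a =>
        simp only [LinearMap.rTensor_tmul, hc]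
        generalize V.coact m = t
        induction t with
        | zero => simp
        | add x y hx hy => simp only [map_add, TensorProduct.add_tmul, hx, hy]
        | tmul m b => simp
    · rw [hc, V.coassoc]
      generalize V.coact v = t
      induction t with
      | zero => simp
      | add x y hx hy => simp only [map_add, hx, hy]
      | tmul m a => simp

theorem exists_kernel {V W : RightComod k A} (g : V ⟶ W) :
    ∃ (T : RightComod k A) (t : T ⟶ V), t ≫ g = 0 ∧ ∀ v, g.lin v = 0 → ∃ x, t.lin x = v := by
  let K := LinearMap.ker g.lin
  have hi := Module.Flat.rTensor_preserves_injective_linearMap (M := A) K.subtype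
    K.injective_subtype
  have hex : Function.Exact (K.subtype.rTensor A) (g.lin.rTensor A) :=
    Module.Flat.rTensor_exact A (LinearMap.exact_subtype_ker_map g.lin)
  have hr : ∀ x : K, (V.coact ∘ₗ K.subtype) x ∈ LinearMap.range (K.subtype.rTensor A) := by
    intro x
    refine (hex _).1 ?_
    rw [LinearMap.comp_apply, ← g.colinear, show g.lin (K.subtype x) = 0 from x.2, map_zero]
  let c : K →ₗ[k] K ⊗[k] A := (LinearEquiv.ofInjective _ hi).symm.toLinearMap ∘ₗ
    (V.coact ∘ₗ K.subtype).codRestrict _ hr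
  have hc : ∀ x, V.coact (K.subtype x) = K.subtype.rTensor A (c x) := by
    intro x
    have := (LinearEquiv.ofInjective _ hi).apply_symm_apply
      ((V.coact ∘ₗ K.subtype).codRestrict _ hr x)
    exact (congrArg Subtype.val this).symm
  exact ⟨V.ofInjective K.subtype K.injective_subtype c hc, ⟨K.subtype, hc⟩,
    hom_ext (LinearMap.ext fun x => x.2), fun v hv => ⟨⟨v, hv⟩, rfl⟩⟩

theorem exists_cokernel {U V : RightComod k A} (f : U ⟶ V) :
    ∃ (S : RightComod k A) (s : V ⟶ S), f ≫ s = 0 ∧ ∀ v, s.lin v = 0 → ∃ x, f.lin x = v := by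
  let I := LinearMap.range f.lin
  let c : (V.carrier ⧸ I) →ₗ[k] (V.carrier ⧸ I) ⊗[k] A :=
    I.liftQ (I.mkQ.rTensor A ∘ₗ V.coact) (by
      rintro _ ⟨u, rfl⟩
      have : I.mkQ ∘ₗ f.lin = 0 := LinearMap.range_mkQ_comp f.lin
      rw [LinearMap.mem_ker, LinearMap.comp_apply, f.colinear, ← LinearMap.rTensor_comp_apply, this]
      simp)
  have hc : ∀ v, c (I.mkQ v) = I.mkQ.rTensor A (V.coact v) := fun v => rfl
  refine ⟨V.ofSurjective I.mkQ I.mkQ_surjective c hc, ⟨I.mkQ, hc⟩,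
    hom_ext (LinearMap.range_mkQ_comp f.lin), fun v hv => ?_⟩
  exact (Submodule.Quotient.mk_eq_zero I).1 hv

theorem exact_iff {U V W : RightComod k A} (f : U ⟶ V) (g : V ⟶ W) :
    Function.Exact f.lin g.lin ↔ f ≫ g = 0 ∧
      ∀ (T S : RightComod k A) (t : T ⟶ V) (s : V ⟶ S), t ≫ g = 0 → f ≫ s = 0 → t ≫ s = 0 := by
  constructor
  · intro h
    refine ⟨hom_ext (LinearMap.ext h.apply_apply_eq_zero), fun T S t s ht hs => ?_⟩
    refine hom_ext (LinearMap.ext fun x => ?_)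
    obtain ⟨u, hu⟩ := (h (t.lin x)).1 (LinearMap.congr_fun (congrArg RightComod.Hom.lin ht) x)
    change s.lin (t.lin x) = 0
    rw [← hu]
    exact LinearMap.congr_fun (congrArg RightComod.Hom.lin hs) u
  · rintro ⟨h0, h⟩ v
    constructor
    · intro hv
      obtain ⟨T, t, ht, ht'⟩ := exists_kernel g
      obtain ⟨S, s, hs, hs'⟩ := exists_cokernel f
      obtain ⟨x, rfl⟩ := ht' v hv
      exact hs' _ (LinearMap.congr_fun (congrArg RightComod.Hom.lin (h T S t s ht hs)) x)
    · rintro ⟨u, rfl⟩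
      exact LinearMap.congr_fun (congrArg RightComod.Hom.lin h0) u

variable {H : Type u} [Ring H] [HopfAlgebra k H]

theorem exact_map (F : RightComod k A ⥤ RightComod k H) [F.IsEquivalence] [F.Additive]
    {U V W : RightComod k A} {f : U ⟶ V} {g : V ⟶ W} (h : Function.Exact f.lin g.lin) :
    Function.Exact (F.map f).lin (F.map g).lin := by
  obtain ⟨h0, h1⟩ := (exact_iff f g).1 h
  refine (exact_iff _ _).2 ⟨by rw [← F.map_comp, h0, F.map_zero], fun T S t s ht hs => ?_⟩
  obtain ⟨t', ht'⟩ := F.map_surjective ((F.objObjPreimageIso T).hom ≫ t)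
  obtain ⟨s', hs'⟩ := F.map_surjective (s ≫ (F.objObjPreimageIso S).inv)
  have h2 : t' ≫ s' = 0 := by
    refine h1 _ _ t' s' (F.map_injective ?_) (F.map_injective ?_)
    · rw [F.map_comp, ht', Category.assoc, ht, Limits.comp_zero, F.map_zero]
    · rw [F.map_comp, hs', reassoc_of% hs, Limits.zero_comp, F.map_zero]
  have h3 := congrArg F.map h2
  rw [F.map_comp, ht', hs', F.map_zero, Category.assoc, ← Category.assoc t,
    ← Limits.comp_zero (f := (F.objObjPreimageIso T).hom), cancel_epi,
    ← Limits.zero_comp (f := (F.objObjPreimageIso S).inv), cancel_mono] at h3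
  exact h3

theorem surjective_map (F : RightComod k A ⥤ RightComod k H) [F.IsEquivalence] [F.Additive]
    {U V : RightComod k A} {f : U ⟶ V} (h : Function.Surjective f.lin) :
    Function.Surjective (F.map f).lin := by
  have h1 : Function.Exact f.lin (0 : V ⟶ V).lin := fun v => ⟨fun _ => h v, fun _ => rfl⟩
  have h2 := exact_map F h1
  rw [F.map_zero] at h2
  exact fun v => (h2 v).1 rfl

theorem nontrivial_iff (V : RightComod k A) : Nontrivial V.carrier ↔ 𝟙 V ≠ 0 := by
  rw [← not_subsingleton_iff_nontrivial, not_iff_not]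
  constructor
  · intro h
    exact hom_ext (LinearMap.ext fun v => Subsingleton.elim _ _)
  · intro h
    have h1 : ∀ v : V.carrier, v = 0 :=
      fun v => LinearMap.congr_fun (congrArg RightComod.Hom.lin h) v
    exact ⟨fun a b => (h1 a).trans (h1 b).symm⟩

theorem nontrivial_map_iff (F : RightComod k A ⥤ RightComod k H) [F.Faithful] [F.Additive]
    (V : RightComod k A) : Nontrivial (F.obj V).carrier ↔ Nontrivial V.carrier := by
  rw [nontrivial_iff, nontrivial_iff, not_iff_not, ← F.map_id]
  exact F.map_eq_zero_iff

end RightComod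

namespace YetterDrinfeld
variable {k A : Type u} [Field k] [Ring A] [HopfAlgebra k A]

theorem map_act_colinear {V : RightComod k A} {W : YetterDrinfeld k A}
    (g : V ⟶ W.toRightComod) (t : V.carrier ⊗[k] A) :
    W.coact (TensorProduct.lift (W.act ∘ₗ g.lin) t) =
      (TensorProduct.lift (W.act ∘ₗ g.lin)).rTensor A (freeCoact V.coact t) := by
  induction t with
  | zero => simp
  | add x y hx hy => simp only [map_add, hx, hy]
  | tmul v a =>
  rw [freeCoact_tmul, TensorProduct.lift.tmul, LinearMap.comp_apply, W.compat, g.colinear]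
  generalize V.coact v = s
  generalize comul₃ k A a = t
  induction s with
  | zero => simp
  | add x y hx hy => simp only [map_add, TensorProduct.add_tmul, hx, hy]
  | tmul v b =>
  induction t using triple_induction with
  | zero => simp
  | add x y hx hy => simp only [map_add, TensorProduct.tmul_add, hx, hy]
  | tmul x y z => simp [adTwist_tmul]

theorem map_act_linear {V : RightComod k A} {W : YetterDrinfeld k A}
    (g : V ⟶ W.toRightComod) (t : V.carrier ⊗[k] A) (a : A) :
    TensorProduct.lift (W.act ∘ₗ g.lin) (freeAct t a) =
      W.act (TensorProduct.lift (W.act ∘ₗ g.lin) t) a := by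
  induction t with
  | zero => simp
  | add x y hx hy => simp only [map_add, LinearMap.add_apply, hx, hy]
  | tmul v b => simp [freeAct_tmul, W.act_mul]

/-- The Yetter–Drinfeld morphism `v ⊗ a ↦ g(v) a` extending a colinear map `g`. -/
def freeLift {V : RightComod k A} {W : YetterDrinfeld k A} (g : V ⟶ W.toRightComod) :
    (freeFunctor k A).obj V ⟶ W where
  hom := ⟨TensorProduct.lift (W.act ∘ₗ g.lin), map_act_colinear g⟩
  map_act := map_act_linear g

theorem freeCoact_tmul_one (V : RightComod k A) (v : V.carrier) :
    freeCoact V.coact (v ⊗ₜ 1) =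
      ((TensorProduct.mk k V.carrier A).flip 1).rTensor A (V.coact v) := by
  rw [freeCoact_tmul]
  generalize V.coact v = s
  induction s with
  | zero => simp
  | add x y hx hy => simp only [map_add, TensorProduct.add_tmul, hx, hy]
  | tmul v b => simp [comul₃, Algebra.TensorProduct.one_def, adTwist_tmul]

/-- The colinear map `v ↦ v ⊗ 1`. -/
def freeUnit (V : RightComod k A) : V ⟶ ((freeFunctor k A).obj V).toRightComod where
  lin := (TensorProduct.mk k V.carrier A).flip 1
  colinear := freeCoact_tmul_one V

variable (k A) in
/-- The functor `V ↦ V ⊠ A` is left adjoint to the forgetful functor. -/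
def freeAdjunction : freeFunctor k A ⊣ forget k A :=
  Adjunction.mkOfHomEquiv
    { homEquiv V W :=
        { toFun f := freeUnit V ≫ Hom.hom f
          invFun g := freeLift g
          left_inv f := hom_ext (TensorProduct.ext' fun v a => by
            change W.act (Hom.lin f (v ⊗ₜ 1)) a = Hom.lin f (v ⊗ₜ a)
            refine (f.map_act (v ⊗ₜ[k] (1 : A)) a).symm.trans (congrArg (Hom.lin f) ?_)
            change freeAct (v ⊗ₜ 1) a = _
            rw [freeAct_tmul, one_mul])
          right_inv g := RightComod.hom_ext (LinearMap.ext fun v => W.act_one (g.lin v)) }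
      homEquiv_naturality_left_symm f g := hom_ext (TensorProduct.ext' fun v a => rfl)
      homEquiv_naturality_right f g := rfl }

end YetterDrinfeld

namespace YetterDrinfeld
open MonoidalCategory
variable {k A H : Type u} [Field k] [Ring A] [HopfAlgebra k A] [Ring H] [HopfAlgebra k H]

/-- A compatible isomorphism of comodules is an isomorphism of Yetter–Drinfeld modules. -/
abbrev isoOfCompatible {V W : YetterDrinfeld k A} (e : V.toRightComod ≅ W.toRightComod)
    (h : V.halfBraiding.Compatible W.halfBraiding e.hom) : V ≅ W :=
  isoMk e (map_act_of_compatible h)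

section Induced
variable (F : RightComod k A ⥤ RightComod k H) [F.Monoidal] [F.IsEquivalence]

/-- The functor between Yetter–Drinfeld modules induced by a tensor equivalence `F` between
categories of comodules: it transports half-braidings. -/
abbrev induced : YetterDrinfeld k A ⥤ YetterDrinfeld k H where
  obj V := (V.halfBraiding.transport F).toYetterDrinfeld
  map {V W} f := ⟨F.map (Hom.hom f), map_act_of_compatible
    (V := (V.halfBraiding.transport F).toYetterDrinfeld)
    (W := (W.halfBraiding.transport F).toYetterDrinfeld) (by
      rw [halfBraiding_toYetterDrinfeld, halfBraiding_toYetterDrinfeld]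
      exact LaxHalfBraiding.transport_compatible F (compatible f))⟩
  map_id V := Hom.ext (F.map_id V.toRightComod)
  map_comp f g := Hom.ext (F.map_comp (Hom.hom f) (Hom.hom g))

theorem halfBraiding_induced (V : YetterDrinfeld k A) :
    ((induced F).obj V).halfBraiding = V.halfBraiding.transport F :=
  halfBraiding_toYetterDrinfeld _

instance : (induced F).Faithful where
  map_injective h := Hom.ext (F.map_injective (congrArg Hom.hom h))

instance : (induced F).Full where
  map_surjective {V W} f := by
    obtain ⟨g, hg⟩ := F.map_surjective (Hom.hom f)
    have h := compatible f
    rw [halfBraiding_induced, halfBraiding_induced, ← hg] at h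
    exact ⟨⟨g, map_act_of_compatible (LaxHalfBraiding.compatible_of_transport F h)⟩, Hom.ext hg⟩

instance : (induced F).EssSurj where
  mem_essImage W := by
    let i : F.obj (F.objPreimage W.toRightComod) ≅ W.toRightComod := F.objObjPreimageIso _
    let V : YetterDrinfeld k A := ((W.halfBraiding.ofIso i.symm).preimage F).toYetterDrinfeld
    refine ⟨V, ⟨(isoOfCompatible (V := W) (W := (induced F).obj V) i.symm ?_).symm⟩⟩
    rw [halfBraiding_induced, halfBraiding_toYetterDrinfeld, LaxHalfBraiding.transport_preimage]
    exact LaxHalfBraiding.ofIso_compatible _ _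

instance : (induced F).IsEquivalence where

instance inducedMonoidal : (induced F).Monoidal :=
  Functor.CoreMonoidal.toMonoidal
    { εIso := isoOfCompatible (V := 𝟙_ (YetterDrinfeld k H))
        (W := (induced F).obj (𝟙_ (YetterDrinfeld k A))) (Functor.Monoidal.εIso F) (by
          rw [halfBraiding_induced]
          exact LaxHalfBraiding.transport_ε_compatible F halfBraiding_unit_β halfBraiding_unit_β)
      μIso V W := isoOfCompatible (V := (induced F).obj V ⊗ (induced F).obj W)
        (W := (induced F).obj (V ⊗ W))
        (Functor.Monoidal.μIso F V.toRightComod W.toRightComod) (by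
          have h := isTensor_halfBraiding ((induced F).obj V) ((induced F).obj W)
          rw [halfBraiding_induced, halfBraiding_induced] at h
          rw [halfBraiding_induced]
          exact LaxHalfBraiding.transport_μ_compatible F (isTensor_halfBraiding V W) h)
      μIso_hom_natural_left f X :=
        Hom.ext (Functor.LaxMonoidal.μ_natural_left F (Hom.hom f) X.toRightComod)
      μIso_hom_natural_right X f :=
        Hom.ext (Functor.LaxMonoidal.μ_natural_right F X.toRightComod (Hom.hom f))
      associativity X Y Z := Hom.ext
        (Functor.LaxMonoidal.associativity F X.toRightComod Y.toRightComod Z.toRightComod)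
      left_unitality X := Hom.ext (Functor.LaxMonoidal.left_unitality F X.toRightComod)
      right_unitality X := Hom.ext (Functor.LaxMonoidal.right_unitality F X.toRightComod) }

instance induced_additive [F.Additive] : (induced F).Additive where
  map_add := Hom.ext F.map_add

instance induced_linear [F.Linear k] : (induced F).Linear k where
  map_smul f c := Hom.ext (Functor.Linear.map_smul (F := F) (Hom.hom f) c)

/-- The induced functor lifts `F` along the forgetful functors. -/
def inducedForgetIso : induced F ⋙ forget k H ≅ forget k A ⋙ F := Iso.refl _

instance inducedForgetIso_isMonoidal : NatTrans.IsMonoidal (inducedForgetIso F).hom where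
  unit := by
    change (Functor.LaxMonoidal.ε (forget k H) ≫
      (forget k H).map (Functor.LaxMonoidal.ε (induced F))) ≫ 𝟙 _ =
        Functor.LaxMonoidal.ε F ≫ F.map (Functor.LaxMonoidal.ε (forget k A))
    change (𝟙 _ ≫ Functor.LaxMonoidal.ε F) ≫ 𝟙 _ = Functor.LaxMonoidal.ε F ≫ F.map (𝟙 _)
    simp
  tensor V W := by
    change (𝟙 _ ≫ Functor.LaxMonoidal.μ F V.toRightComod W.toRightComod) ≫ 𝟙 _ =
      (𝟙 _ ⊗ₘ 𝟙 _) ≫ Functor.LaxMonoidal.μ F V.toRightComod W.toRightComod ≫ F.map (𝟙 _)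
    simp

end Induced

/-- An equivalence that lifts `Θ` along the forgetful functors is compatible with the formation of
free Yetter–Drinfeld modules. -/
def freeIso (Θ : RightComod k A ≌ RightComod k H) (Θ' : YetterDrinfeld k A ≌ YetterDrinfeld k H)
    (γ : Θ'.functor ⋙ forget k H ≅ forget k A ⋙ Θ.functor) :
    freeFunctor k A ⋙ Θ'.functor ≅ Θ.functor ⋙ freeFunctor k H :=
  ((freeAdjunction k A).comp Θ'.toAdjunction).leftAdjointUniq
    ((Θ.toAdjunction.comp (freeAdjunction k H)).ofNatIsoRight
      (Iso.isoCompInverse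
        (Functor.associator _ _ _ ≪≫ Functor.isoWhiskerLeft Θ'.inverse γ.symm ≪≫
          (Functor.associator _ _ _).symm ≪≫ Functor.isoWhiskerRight Θ'.counitIso _ ≪≫
          Functor.leftUnitor _)).symm)

theorem IsFree.of_iso {X Y : YetterDrinfeld k A} (h : IsFree X) (e : X ≅ Y) : IsFree Y := by
  obtain ⟨V, ⟨i⟩⟩ := h
  exact ⟨V, ⟨e.symm ≪≫ i⟩⟩

theorem bijective_lin {X Y : YetterDrinfeld k A} (e : X ≅ Y) :
    Function.Bijective (Hom.lin e.hom) :=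
  Function.bijective_iff_has_inverse.2 ⟨Hom.lin e.inv,
    fun v => LinearMap.congr_fun (congrArg Hom.lin e.hom_inv_id) v,
    fun v => LinearMap.congr_fun (congrArg Hom.lin e.inv_hom_id) v⟩

theorem exact_of_iso {X Y Z X' Y' Z' : YetterDrinfeld k A} {f : X ⟶ Y} {g : Y ⟶ Z}
    {f' : X' ⟶ Y'} {g' : Y' ⟶ Z'} (a : X ≅ X') (b : Y ≅ Y') (c : Z ≅ Z')
    (hf : f ≫ b.hom = a.hom ≫ f') (hg : g ≫ c.hom = b.hom ≫ g')
    (h : Function.Exact (Hom.lin f) (Hom.lin g)) : Function.Exact (Hom.lin f') (Hom.lin g') := by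
  have hf' : ∀ x, Hom.lin b.hom (Hom.lin f x) = Hom.lin f' (Hom.lin a.hom x) :=
    fun x => LinearMap.congr_fun (congrArg Hom.lin hf) x
  have hg' : ∀ x, Hom.lin c.hom (Hom.lin g x) = Hom.lin g' (Hom.lin b.hom x) :=
    fun x => LinearMap.congr_fun (congrArg Hom.lin hg) x
  intro y'
  obtain ⟨y, rfl⟩ := (bijective_lin b).2 y'
  rw [← hg', (map_eq_zero_iff _ (bijective_lin c).1), h y]
  constructor
  · rintro ⟨x, rfl⟩
    exact ⟨_, (hf' x).symm⟩
  · rintro ⟨x', hx⟩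
    obtain ⟨x, rfl⟩ := (bijective_lin a).2 x'
    rw [← hf'] at hx
    exact ⟨x, (bijective_lin b).1 hx⟩

theorem IsFreeResolution.of_iso {P Q : ChainComplex (YetterDrinfeld k A) ℕ}
    {M N : YetterDrinfeld k A} (h : IsFreeResolution P M) (e : ∀ n, P.X n ≅ Q.X n)
    (he : ∀ n, P.d (n + 1) n ≫ (e n).hom = (e (n + 1)).hom ≫ Q.d (n + 1) n) (i : M ≅ N) :
    IsFreeResolution Q N where
  free n := (h.free n).of_iso (e n)
  exact_succ n := exact_of_iso (e (n + 2)) (e (n + 1)) (e n) (he (n + 1)) (he n) (h.exact_succ n)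
  augmentation := by
    obtain ⟨η, h1, h2⟩ := h.augmentation
    refine ⟨(e 0).inv ≫ η ≫ i.hom, exact_of_iso (e 1) (e 0) i (he 0) (by simp) h1, ?_⟩
    exact ((bijective_lin i).2.comp h2).comp (bijective_lin (e 0).symm).2

theorem length_eq_of_nontrivial_iff {P : ChainComplex (YetterDrinfeld k A) ℕ}
    {Q : ChainComplex (YetterDrinfeld k H) ℕ}
    (h : ∀ n, Nontrivial (P.X n).carrier ↔ Nontrivial (Q.X n).carrier) : length P = length Q := by
  simp only [length, h]

section Induced
variable (F : RightComod k A ⥤ RightComod k H) [F.Monoidal] [F.IsEquivalence] [F.Additive]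

theorem isFreeResolution_induced
    (hfree : ∀ V, IsFree ((induced F).obj ((freeFunctor k A).obj V)))
    {P : ChainComplex (YetterDrinfeld k A) ℕ} (h : IsFreeResolution P (trivial k A)) :
    IsFreeResolution (((induced F).mapHomologicalComplex (ComplexShape.down ℕ)).obj P)
      (trivial k H) where
  free n := by
    obtain ⟨V, ⟨i⟩⟩ := h.free n
    exact (hfree V).of_iso ((induced F).mapIso i.symm)
  exact_succ n := RightComod.exact_map F (h.exact_succ n)
  augmentation := by
    obtain ⟨η, h1, h2⟩ := h.augmentation
    refine ⟨(induced F).map η ≫ (Functor.Monoidal.εIso (induced F)).inv, ?_, ?_⟩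
    · exact exact_of_iso (f := (induced F).map (P.d 1 0)) (g := (induced F).map η) (Iso.refl _)
        (Iso.refl _) (Functor.Monoidal.εIso (induced F)).symm
        ((Category.comp_id _).trans (Category.id_comp _).symm) (Category.id_comp _).symm
        (RightComod.exact_map F h1)
    · exact (bijective_lin (Functor.Monoidal.εIso (induced F)).symm).2.comp
        (RightComod.surjective_map F h2)

theorem length_induced (P : ChainComplex (YetterDrinfeld k A) ℕ) :
    length (((induced F).mapHomologicalComplex (ComplexShape.down ℕ)).obj P) = length P :=
  length_eq_of_nontrivial_iff fun n => RightComod.nontrivial_map_iff F (P.X n).toRightComod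

end Induced
end YetterDrinfeld

end

theorem theorem4p1 {k A H : Type u} [Field k] [Ring A] [HopfAlgebra k A] [Ring H] [HopfAlgebra k H]
    (Θ : RightComod k A ≌ RightComod k H)
    [Θ.functor.Monoidal] [Θ.functor.Additive] [Θ.functor.Linear k] :
    ∃ (Θ' : YetterDrinfeld k A ≌ YetterDrinfeld k H)
      (_ : Θ'.functor.Monoidal) (_ : Θ'.functor.Additive) (_ : Θ'.functor.Linear k)
      (γ : Θ'.functor ⋙ YetterDrinfeld.forget k H ≅ YetterDrinfeld.forget k A ⋙ Θ.functor)
      (φ : YetterDrinfeld.freeFunctor k A ⋙ Θ'.functor ≅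
        Θ.functor ⋙ YetterDrinfeld.freeFunctor k H),
      NatTrans.IsMonoidal γ.hom ∧
      (∀ P : ChainComplex (YetterDrinfeld k A) ℕ,
        YetterDrinfeld.IsFreeResolution P (YetterDrinfeld.trivial k A) →
          YetterDrinfeld.IsFreeResolution
            ((Θ'.functor.mapHomologicalComplex (ComplexShape.down ℕ)).obj P)
            (YetterDrinfeld.trivial k H) ∧
          YetterDrinfeld.length ((Θ'.functor.mapHomologicalComplex (ComplexShape.down ℕ)).obj P) =
            YetterDrinfeld.length P) ∧
      (∀ (V : ℕ → RightComod k A)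
        (d : ∀ n, (YetterDrinfeld.freeFunctor k A).obj (V (n + 1)) ⟶
          (YetterDrinfeld.freeFunctor k A).obj (V n))
        (hd : ∀ n, d (n + 1) ≫ d n = 0),
        YetterDrinfeld.IsFreeResolution
            (ChainComplex.of (fun n => (YetterDrinfeld.freeFunctor k A).obj (V n)) d hd)
            (YetterDrinfeld.trivial k A) →
          ∃ hd' : ∀ n,
            (φ.inv.app (V (n + 2)) ≫ Θ'.functor.map (d (n + 1)) ≫ φ.hom.app (V (n + 1))) ≫
              (φ.inv.app (V (n + 1)) ≫ Θ'.functor.map (d n) ≫ φ.hom.app (V n)) = 0,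
            YetterDrinfeld.IsFreeResolution
              (ChainComplex.of
                (fun n => (YetterDrinfeld.freeFunctor k H).obj (Θ.functor.obj (V n)))
                (fun n => φ.inv.app (V (n + 1)) ≫ Θ'.functor.map (d n) ≫ φ.hom.app (V n)) hd')
              (YetterDrinfeld.trivial k H) ∧
            YetterDrinfeld.length
              (ChainComplex.of
                (fun n => (YetterDrinfeld.freeFunctor k H).obj (Θ.functor.obj (V n)))
                (fun n => φ.inv.app (V (n + 1)) ≫ Θ'.functor.map (d n) ≫ φ.hom.app (V n)) hd') =
              YetterDrinfeld.length
                (ChainComplex.of (fun n => (YetterDrinfeld.freeFunctor k A).obj (V n)) d hd)) := by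
  let Θ' := (YetterDrinfeld.induced Θ.functor).asEquivalence
  let γ : Θ'.functor ⋙ YetterDrinfeld.forget k H ≅ YetterDrinfeld.forget k A ⋙ Θ.functor :=
    YetterDrinfeld.inducedForgetIso Θ.functor
  let φ := YetterDrinfeld.freeIso Θ Θ' γ
  have hfree : ∀ V, YetterDrinfeld.IsFree
      ((YetterDrinfeld.induced Θ.functor).obj ((YetterDrinfeld.freeFunctor k A).obj V)) :=
    fun V => ⟨Θ.functor.obj V, ⟨φ.app V⟩⟩
  refine ⟨Θ', YetterDrinfeld.inducedMonoidal Θ.functor,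
    YetterDrinfeld.induced_additive Θ.functor,
    YetterDrinfeld.induced_linear Θ.functor, γ, φ,
    YetterDrinfeld.inducedForgetIso_isMonoidal Θ.functor,
    fun P hP => ⟨YetterDrinfeld.isFreeResolution_induced Θ.functor hfree hP,
      YetterDrinfeld.length_induced Θ.functor P⟩, fun V d hd hP => ?_⟩
  have hd' : ∀ n,
      (φ.inv.app (V (n + 2)) ≫ Θ'.functor.map (d (n + 1)) ≫ φ.hom.app (V (n + 1))) ≫
        (φ.inv.app (V (n + 1)) ≫ Θ'.functor.map (d n) ≫ φ.hom.app (V n)) = 0 := by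
    intro n
    rw [Category.assoc, Category.assoc, Iso.hom_inv_id_app_assoc, ← Θ'.functor.map_comp_assoc,
      hd, Functor.map_zero, Limits.zero_comp, Limits.comp_zero]
  refine ⟨hd', ?_, ?_⟩
  · refine (YetterDrinfeld.isFreeResolution_induced Θ.functor hfree hP).of_iso
      (fun n => φ.app (V n)) (fun n => ?_) (Iso.refl _)
    change Θ'.functor.map (ChainComplex.of.d
        (fun n => (YetterDrinfeld.freeFunctor k A).obj (V n)) d (n + 1) n) ≫ φ.hom.app (V n) =
      φ.hom.app (V (n + 1)) ≫ ChainComplex.of.d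
        (fun n => (YetterDrinfeld.freeFunctor k H).obj (Θ.functor.obj (V n)))
        (fun n => φ.inv.app (V (n + 1)) ≫ Θ'.functor.map (d n) ≫ φ.hom.app (V n)) (n + 1) n
    rw [ChainComplex.of_d, ChainComplex.of_d, Iso.hom_inv_id_app_assoc]
  · refine YetterDrinfeld.length_eq_of_nontrivial_iff fun n => ?_
    refine Iff.trans ?_ (RightComod.nontrivial_map_iff Θ.functor
      ((YetterDrinfeld.freeFunctor k A).obj (V n)).toRightComod)
    exact (Equiv.ofBijective _ (YetterDrinfeld.bijective_lin (φ.app (V n)))).nontrivial_congr.symm
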